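/- Let $K$ be a non-archimedean local field with valuation ring $\mathcal O_K$, maximal ideal $\mathcal M_K$ and residue field of $q_K$ elements, with its norm normalized so that uniformizers have norm $q_K^{-1}$. For $x\in K^m$ put $|x|=\max_i|x_i|$. Let $\psi$ be an additive character of $K$ that is trivial on $\mathcal M_K$ and nontrivial on $\mathcal O_K$, and let $|dx|$ be the Haar measure on $K^d$ for which $\mathcal O_K^d$ has measure $1$. Let $n\ge 0$, $d\ge 0$ and $k\ge 1$ be integers, and suppose that $K$ has characteristic $0$ or characteristic $>k$. Let $f=(f_1,\dots,f_n)$, where each $f_l=\sum_{i\in\mathbb N^d}a_{l,i}x^i\in K[[x_1,\dots,x_d]]$ converges on $\mathcal O_K^d$, that is, $|a_{l,i}|\to 0$ as $i_1+\dots+i_d\to\infty$. Put $\|f-f(0)\|=\max_l\sup_{i\ne 0}|a_{l,i}|$. Suppose that for every $v\in K^n$ with $|v|=1$ and every $x\in\mathcal O_K^d$ there is a multi-index $\alpha\in\mathbb N^d$ with $0<|\alpha|\le k$, where $|\alpha|=\sum_j\alpha_j$, such that $$\Bigl|\sum_{l=1}^n v_l\,\partial^\alpha f_l(x)\Bigr|\ge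 1 .$$ Then there is a constant $c$, depending only on $K$, $n$, $k$ and $\|f-f(0)\|$, such that for all nonzero $y\in K^n$ $$\Bigl|\int_{\mathcal O_K^d}\psi\Bigl(\sum_{l=1}^n y_l f_l(x)\Bigr)\,|dx|\Bigr|\le c\,|y|^{-1/k}.$$ -/

import Mathlib

open Filter Topology MeasureTheory

noncomputable section

namespace VanDerCorput

section Field

variable (K : Type*) [NontriviallyNormedField K] [IsUltrametricDist K]

/-- The valuation ring `𝓞_K = {a | ‖a‖ ≤ 1}` of a nonarchimedean normed field. -/
abbrev integers : Subring K := (NormedField.valuation (K := K)).integer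

/-- The number `q_K` of elements of the residue field `𝓞_K / 𝓜_K`. -/
def residueCard : ℕ := Nat.card (IsLocalRing.ResidueField (integers K))

/-- The norm on `K` is the normalized one: every uniformizer has norm `q_K⁻¹`. -/
def IsNormalized : Prop :=
  ∀ ϖ : integers K, Irreducible ϖ → ‖(ϖ : K)‖ = (residueCard K : ℝ)⁻¹

end Field

section Measure

variable (K : Type*) [NontriviallyNormedField K] [LocallyCompactSpace K]

/-- The closed unit ball `𝓞_K` of a locally compact field, as a compact set with nonempty
interior. -/
def unitBall : TopologicalSpace.PositiveCompacts K where
  carrier := Metric.closedBall 0 1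
  isCompact' := by
    have : ProperSpace K := ProperSpace.of_locallyCompactSpace K
    exact isCompact_closedBall 0 1
  interior_nonempty' :=
    ⟨0, Metric.ball_subset_interior_closedBall (Metric.mem_ball_self one_pos)⟩

/-- The Haar measure on `K`, normalized so that `𝓞_K` has measure `1`. -/
def haar [MeasurableSpace K] [BorelSpace K] : Measure K := Measure.addHaarMeasure (unitBall K)

/-- The Haar measure `|dx|` on `K^d`, normalized so that `𝓞_K^d` has measure `1`. -/
def haarPi [MeasurableSpace K] [BorelSpace K] (d : ℕ) : Measure (Fin d → K) :=
  Measure.pi fun _ => haar K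

end Measure

section PowerSeries

variable {K : Type*} [NontriviallyNormedField K]

/-- The polydisc `𝓞_K^d`. -/
def polydisc (K : Type*) [NontriviallyNormedField K] (d : ℕ) : Set (Fin d → K) :=
  {x | ∀ j, ‖x j‖ ≤ 1}

/-- `f ∈ K{{x}}`: the coefficients tend to zero, i.e. `f` converges on `𝓞_K^d`. -/
def IsConvergent {d : ℕ} (f : MvPowerSeries (Fin d) K) : Prop :=
  MvPowerSeries.IsRestricted (fun _ => (1 : ℝ)) f

/-- The value `f(x) = ∑ aᵢ xⁱ`; the series is summable when `f` converges on `𝓞_K^d` and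
`x ∈ 𝓞_K^d`. -/
def eval {d : ℕ} (f : MvPowerSeries (Fin d) K) (x : Fin d → K) : K :=
  ∑' i : Fin d →₀ ℕ, MvPowerSeries.coeff i f * ∏ j, x j ^ i j

/-- The iterated formal partial derivative
`∂^α f = (∂/∂x_1)^{α_1} ⋯ (∂/∂x_d)^{α_d} f`. -/
def partialDeriv {d : ℕ} (α : Fin d → ℕ) (f : MvPowerSeries (Fin d) K) :
    MvPowerSeries (Fin d) K :=
  ((List.finRange d).map fun j =>
    ((MvPowerSeries.pderiv K j : MvPowerSeries (Fin d) K →ₗ[K] MvPowerSeries (Fin d) K) :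
      Module.End K (MvPowerSeries (Fin d) K)) ^ α j).prod f

/-- The Gauss norm `‖f - f(0)‖` of a tuple of power series: the largest of the Gauss norms of
`f_1 - f_1(0), …, f_n - f_n(0)`. -/
def gaussNormSubConst {n d : ℕ} (f : Fin n → MvPowerSeries (Fin d) K) : ℝ :=
  ⨆ l, MvPowerSeries.gaussNorm (fun a : K => ‖a‖) (fun _ => (1 : ℝ))
    (f l - MvPowerSeries.C (MvPowerSeries.constantCoeff (f l)))

end PowerSeries

end VanDerCorput

end

/-! The estimate is reduced to one-variable polynomials on short lines, where a stationary phase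
argument applies. Write `y = λ v` with `|λ| = |y|` and `|v| = 1`. Dropping the small coefficients of
the `f_l` turns `∑ v_l f_l` into a polynomial `P`. The phase does not change, because `ψ` is trivial
on the maximal ideal, and a derivative of norm at least `1` keeps its norm, because the norm is
ultrametric.

If `∂^α P(x)` has norm at least `1` and `j = |α| ≤ k`, polarization writes it, up to sign, as a
signed sum of `j`-th Taylor coefficients of `P` along lines through `x`. Hence one of these
coefficients has norm at least `1` (`exists_direction`), and this persists on a ball of radius `R =
‖ϖ‖ ^ s` around `x`, where `s` depends only on `K`, `k` and the coefficient bound `M`.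

On such a line, let `h` be the restriction of `P`. Its derivative has fewer than `k` roots in the
disc of radius `R` of an algebraic closure (`norm_coeff_prod_roots_le`). Away from discs of radius
`ρ` near these roots, the linear Taylor term of `h` dominates and has size at least `|k!| ρ^(k-1)`
(`exists_finset_linear_term_dominates`). There the integral vanishes by orthogonality of characters
as soon as `|λ| |k!| R ρ^k ≥ 1`. The excluded discs have relative measure at most `kρ/R`, and the
smallest admissible `ρ` gives `|λ|^(-1/k)` (`norm_integral_line_le`).

Averaging over translations (`norm_setIntegral_le_of_average`) passes from lines to the polydisc
without loss, so the constant does not depend on `d`. -/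

/-- The polarization identity: inclusion–exclusion over the subsets of a finite family recovers the
product of the family from the powers of its partial sums. -/
theorem sum_powerset_neg_one_pow_mul_sum_pow_card {ι R : Type*} [Fintype ι] [DecidableEq ι]
    [CommRing R] (x : ι → R) :
    ∑ S ∈ (Finset.univ : Finset ι).powerset, (-1) ^ S.card * (∑ s ∈ S, x s) ^ Fintype.card ι =
      (-1) ^ Fintype.card ι * ((Fintype.card ι).factorial : R) * ∏ i, x i := by
  -- The power is a sum over all maps `φ : ι → ι`, with an indicator that `φ` avoids the complement
  -- of `S`. The index set thus no longer depends on `S`, and the two sums can be exchanged.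
  have expand (S : Finset ι) : (∑ s ∈ S, x s) ^ Fintype.card ι =
      ∑ φ : ι → ι, (∏ i ∈ Finset.univ \ S, if ∀ j, φ j ≠ i then (1 : R) else 0) *
        ∏ i, x (φ i) := by
    have h1 : (∑ s ∈ S, x s) ^ Fintype.card ι = ∏ _i : ι, ∑ s ∈ S, x s := by simp
    rw [h1, Finset.prod_univ_sum]
    have h2 : (Fintype.piFinset fun _ : ι => S) =
        Finset.univ.filter fun φ : ι → ι => ∀ i, φ i ∈ S := by
      ext φ; simp
    rw [h2, Finset.sum_filter]
    refine Finset.sum_congr rfl fun φ _ => ?_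
    rw [Finset.prod_ite_zero]
    have h3 : (∀ i ∈ Finset.univ \ S, ∀ j, φ j ≠ i) ↔ ∀ i, φ i ∈ S := by
      constructor
      · intro h i
        by_contra hi
        exact h (φ i) (by simpa using hi) i rfl
      · rintro h i hi j rfl
        simp [h j] at hi
    by_cases h : ∀ i, φ i ∈ S
    · rw [if_pos h, if_pos (h3.2 h)]; simp
    · rw [if_neg h, if_neg (mt h3.1 h)]; simp
  simp_rw [expand, Finset.mul_sum]
  rw [Finset.sum_comm]
  have inner (φ : ι → ι) : ∑ S ∈ (Finset.univ : Finset ι).powerset, (-1) ^ S.card *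
      ((∏ i ∈ Finset.univ \ S, if ∀ j, φ j ≠ i then (1 : R) else 0) * ∏ i, x (φ i)) =
      if Function.Injective φ then (-1) ^ Fintype.card ι * ∏ i, x i else 0 := by
    -- The signed sum over `S` factors as the product over `i` of `-1 + [φ misses i]`. It vanishes
    -- unless `φ` is surjective, so only the permutations survive.
    have h1 := Finset.prod_add (fun _ : ι => (-1 : R))
      (fun i => if ∀ j, φ j ≠ i then (1 : R) else 0) Finset.univ
    simp_rw [Finset.prod_const] at h1
    simp_rw [← mul_assoc]
    rw [← Finset.sum_mul, ← h1]
    split_ifs with hφ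
    · have hs := Finite.injective_iff_surjective.1 hφ
      have h2 : ∀ i, ¬ ∀ j, φ j ≠ i := fun i h => by
        obtain ⟨j, hj⟩ := hs i
        exact h j hj
      have h3 : ∏ i, x (φ i) = ∏ i, x i :=
        (Equiv.ofBijective φ ⟨hφ, hs⟩).prod_comp x
      simp [h2, h3]
    · have hs : ¬ Function.Surjective φ := mt Finite.injective_iff_surjective.2 hφ
      simp only [Function.Surjective, not_forall, not_exists] at hs
      obtain ⟨i, hi⟩ := hs
      rw [Finset.prod_eq_zero (Finset.mem_univ i), zero_mul]
      simp [hi]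
  simp_rw [inner]
  rw [← Finset.sum_filter, Finset.sum_const]
  have hcard : (Finset.univ.filter fun φ : ι → ι => Function.Injective φ).card =
      (Fintype.card ι).factorial := by
    rw [← Fintype.card_subtype, Fintype.card_congr (Equiv.subtypeInjectiveEquivEmbedding ι ι),
      Fintype.card_embedding_eq, Nat.descFactorial_self]
  rw [hcard, nsmul_eq_mul]
  ring

/-! ### Restriction to lines and polarization of partial derivatives. -/

namespace VanDerCorput

/-- The restriction `T ↦ P(x + T u)` of a polynomial to a line. -/
noncomputable def lineRestrict {R σ : Type*} [CommRing R] (x u : σ → R) :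
    MvPolynomial σ R →ₐ[R] Polynomial R :=
  MvPolynomial.aeval fun i => Polynomial.C (x i) + Polynomial.C (u i) * Polynomial.X

section Algebra

variable {R σ : Type*} [CommRing R]

lemma eval_lineRestrict (x u : σ → R) (P : MvPolynomial σ R) (t : R) :
    (lineRestrict x u P).eval t = MvPolynomial.eval (fun i => x i + t * u i) P := by
  have : ((Polynomial.evalRingHom t).comp (lineRestrict x u : MvPolynomial σ R →+* Polynomial R)) =
      MvPolynomial.eval (fun i => x i + t * u i) := by
    ext i
    · simp
    · simp [lineRestrict]
      ring
  exact congrArg (fun φ : MvPolynomial σ R →+* R => φ P) this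

lemma taylor_lineRestrict (x u : σ → R) (P : MvPolynomial σ R) (a : R) :
    Polynomial.taylor a (lineRestrict x u P) = lineRestrict (fun i => x i + a * u i) u P := by
  have : (Polynomial.taylorAlgHom a).comp (lineRestrict x u) =
      lineRestrict (fun i => x i + a * u i) u := by
    ext i : 1
    simp [lineRestrict, Polynomial.taylor_mul]
    ring
  exact congrArg (fun φ : MvPolynomial σ R →ₐ[R] Polynomial R => φ P) this

/-- The derivative of a polynomial in the direction `u`, as a linear endomorphism. -/
noncomputable def dirDeriv [Fintype σ] (u : σ → R) : Module.End R (MvPolynomial σ R) :=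
  ∑ i, u i • ((MvPolynomial.pderiv i : Derivation R _ _) : Module.End R (MvPolynomial σ R))

lemma derivative_lineRestrict [Fintype σ] (x u : σ → R) (P : MvPolynomial σ R) :
    Polynomial.derivative (lineRestrict x u P) = lineRestrict x u (dirDeriv u P) := by
  classical
  induction P using MvPolynomial.induction_on with
  | C a => simp [dirDeriv, lineRestrict, LinearMap.sum_apply]
  | add p q hp hq => simp [hp, hq]
  | mul_X p i hp =>
    have hX : dirDeriv u (p * MvPolynomial.X i) =
        dirDeriv u p * MvPolynomial.X i + p * MvPolynomial.C (u i) := by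
      simp only [dirDeriv, LinearMap.sum_apply, LinearMap.smul_apply]
      simp [Derivation.leibniz, MvPolynomial.pderiv_X, Finset.sum_add_distrib, smul_add,
        Pi.single_apply, MvPolynomial.smul_eq_C_mul, Finset.sum_mul]
      rw [add_comm]
      congr 1
      · exact Finset.sum_congr rfl fun _ _ => by ring
      · ring
    rw [hX, map_mul, Polynomial.derivative_mul, hp, map_add, map_mul, map_mul]
    congr 1
    simp [lineRestrict]

lemma iterate_derivative_lineRestrict [Fintype σ] (x u : σ → R) (P : MvPolynomial σ R) (j : ℕ) :
    Polynomial.derivative^[j] (lineRestrict x u P) = lineRestrict x u ((dirDeriv u ^ j) P) := by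
  induction j with
  | zero => simp
  | succ j ih =>
    rw [Function.iterate_succ_apply', ih, derivative_lineRestrict, pow_succ']
    rfl

lemma eval_dirDeriv_pow [Fintype σ] (x u : σ → R) (P : MvPolynomial σ R) (j : ℕ) :
    MvPolynomial.eval x ((dirDeriv u ^ j) P) =
      (j.factorial : R) * (lineRestrict x u P).coeff j := by
  have h := congrArg (Polynomial.eval 0) (iterate_derivative_lineRestrict x u P j)
  rw [eval_lineRestrict] at h
  simp only [zero_mul, add_zero] at h
  rw [← h, ← Polynomial.coeff_zero_eq_eval_zero, Polynomial.coeff_iterate_derivative]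
  simp [Nat.descFactorial_self]

/-- The iterated partial derivative of a polynomial. -/
noncomputable def polyPartialDeriv {d : ℕ} (α : Fin d → ℕ) : Module.End R (MvPolynomial (Fin d) R) :=
  ((List.finRange d).map fun j =>
    ((MvPolynomial.pderiv j : Derivation R _ _) : Module.End R (MvPolynomial (Fin d) R)) ^ α j).prod

lemma pderiv_commute (i j : σ) :
    Commute ((MvPolynomial.pderiv i : Derivation R _ _) : Module.End R (MvPolynomial σ R))
      ((MvPolynomial.pderiv j : Derivation R _ _) : Module.End R (MvPolynomial σ R)) := by
  classical
  refine LinearMap.ext fun P => ?_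
  have : ⁅(MvPolynomial.pderiv i : Derivation R (MvPolynomial σ R) (MvPolynomial σ R)),
      (MvPolynomial.pderiv j : Derivation R (MvPolynomial σ R) (MvPolynomial σ R))⁆ = 0 := by
    ext k : 1
    simp [Derivation.commutator_apply, MvPolynomial.pderiv_X, Pi.single_apply]
    split_ifs <;> simp
  have h2 := congrArg (fun D : Derivation R (MvPolynomial σ R) (MvPolynomial σ R) => D P) this
  simpa [Derivation.commutator_apply, sub_eq_zero] using h2

open scoped IsMulCommutative in
/-- Iterated partial derivatives are combinations of powers of directional derivatives. -/
lemma factorial_smul_polyPartialDeriv {d : ℕ} (α : Fin d → ℕ) :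
    ∑ S ∈ (Finset.univ : Finset (Σ j, Fin (α j))).powerset,
      (-1) ^ S.card * dirDeriv (R := R) (fun i => ∑ s ∈ S, (Pi.single s.1 1 : Fin d → R) i) ^ (∑ j, α j) =
      (-1) ^ (∑ j, α j) * (((∑ j, α j).factorial : ℕ) : Module.End R (MvPolynomial (Fin d) R)) *
        polyPartialDeriv α := by
  classical
  let D : Fin d → Module.End R (MvPolynomial (Fin d) R) := fun j =>
    ((MvPolynomial.pderiv j : Derivation R _ _) : Module.End R (MvPolynomial (Fin d) R))
  -- Polarization needs a commutative ring, so it is applied in the subalgebra generated by the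
  -- commuting partial derivatives. The index type `Σ j, Fin (α j)` repeats the `j`-th one `α j`
  -- times.
  have := Algebra.isMulCommutative_adjoin (s := Set.range D) R (by
    rintro _ ⟨i, rfl⟩ _ ⟨j, rfl⟩
    exact pderiv_commute i j)
  let E : Fin d → Algebra.adjoin R (Set.range D) := fun j =>
    ⟨D j, Algebra.subset_adjoin ⟨j, rfl⟩⟩
  have hcard : Fintype.card (Σ j, Fin (α j)) = ∑ j, α j := by simp
  have key := congrArg (Algebra.adjoin R (Set.range D)).val
    (sum_powerset_neg_one_pow_mul_sum_pow_card fun s : Σ j, Fin (α j) => E s.1)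
  rw [hcard] at key
  have hprod : ∏ s : Σ j, Fin (α j), E s.1 = ((List.finRange d).map fun j => E j ^ α j).prod := by
    rw [Fintype.prod_sigma, ← List.ofFn_eq_map, List.prod_ofFn]
    simp
  rw [hprod] at key
  have hdir (S : Finset (Σ j, Fin (α j))) :
      dirDeriv (R := R) (fun i => ∑ s ∈ S, (Pi.single s.1 1 : Fin d → R) i) = ∑ s ∈ S, D s.1 := by
    simp only [dirDeriv, Finset.sum_smul]
    rw [Finset.sum_comm]
    refine Finset.sum_congr rfl fun s _ => ?_
    simp [Pi.single_apply, D]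
  simp_rw [hdir]
  simpa [map_sum, map_mul, map_pow, map_list_prod, E, polyPartialDeriv, D, Function.comp_def]
    using key

/-- The `j`-th power of a directional derivative is `j!` times a Taylor coefficient, and
polarization produces the same `j!` on the other side. Once `j! ≠ 0` it cancels completely, so
passing from derivatives to Taylor coefficients costs no constant. -/
lemma factorial_mul_eval_polyPartialDeriv {d : ℕ} (α : Fin d → ℕ) (P : MvPolynomial (Fin d) R)
    (x : Fin d → R) :
    ∑ S ∈ (Finset.univ : Finset (Σ j, Fin (α j))).powerset,
      (-1) ^ S.card * (((∑ j, α j).factorial : R) *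
        (lineRestrict x (fun i => ∑ s ∈ S, (Pi.single s.1 1 : Fin d → R) i) P).coeff (∑ j, α j)) =
      (-1) ^ (∑ j, α j) * ((∑ j, α j).factorial : R) *
        MvPolynomial.eval x (polyPartialDeriv α P) := by
  have h := congrArg (fun T : Module.End R (MvPolynomial (Fin d) R) => MvPolynomial.eval x (T P))
    (factorial_smul_polyPartialDeriv (R := R) α)
  have hs (n : ℕ) (T : Module.End R (MvPolynomial (Fin d) R)) :
      MvPolynomial.eval x (((-1) ^ n * T) P) = (-1) ^ n * MvPolynomial.eval x (T P) := by
    rcases Nat.even_or_odd n with h' | h'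
    · have e : ((-1) ^ n : Module.End R (MvPolynomial (Fin d) R)) = 1 :=
        Even.neg_one_pow (α := Module.End R (MvPolynomial (Fin d) R)) h'
      rw [e, h'.neg_one_pow, one_mul, one_mul]
    · have e : ((-1) ^ n : Module.End R (MvPolynomial (Fin d) R)) = -1 :=
        Odd.neg_one_pow (α := Module.End R (MvPolynomial (Fin d) R)) h'
      rw [e, h'.neg_one_pow]
      simp
  simp only [LinearMap.sum_apply, map_sum, hs, eval_dirDeriv_pow, mul_assoc] at h
  rw [h]
  simp [Module.End.mul_apply, Module.End.natCast_apply, mul_assoc]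

end Algebra

lemma norm_sub_le_max_norm {E : Type*} [SeminormedAddCommGroup E] [IsUltrametricDist E]
    (x y : E) : ‖x - y‖ ≤ max ‖x‖ ‖y‖ := by
  simpa [sub_eq_add_neg] using IsUltrametricDist.norm_add_le_max x (-y)

/-! ### Size of coefficients and location of roots. -/

section Roots

variable {L : Type*} [NormedField L]

lemma norm_coeff_zero_X_sub_C_mul (p : Polynomial L) (r : L) :
    ‖((Polynomial.X - Polynomial.C r) * p).coeff 0‖ = ‖r‖ * ‖p.coeff 0‖ := by
  simp [sub_mul]

variable [IsUltrametricDist L]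

lemma norm_coeff_X_sub_C_mul_le (p : Polynomial L) (r : L) (i : ℕ) :
    ‖((Polynomial.X - Polynomial.C r) * p).coeff (i + 1)‖ ≤
      max ‖p.coeff i‖ (‖r‖ * ‖p.coeff (i + 1)‖) := by
  rw [sub_mul, Polynomial.coeff_sub, Polynomial.coeff_X_mul, Polynomial.coeff_C_mul, ← norm_mul]
  exact norm_sub_le_max_norm _ _

/-- The number of roots of norm at most `R` is the last index at which `‖pᵢ‖ Rⁱ` is maximal. -/
lemma norm_coeff_prod_roots_le (s : Multiset L) {R : ℝ} (hR : 0 < R) :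
    ∀ i, let p := (s.map fun r => Polynomial.X - Polynomial.C r).prod
      let m := Multiset.countP (fun r => ‖r‖ ≤ R) s
      ‖p.coeff i‖ * R ^ i ≤ ‖p.coeff m‖ * R ^ m ∧
        (m < i → ‖p.coeff i‖ * R ^ i < ‖p.coeff m‖ * R ^ m) := by
  induction s using Multiset.induction_on with
  | empty =>
    intro i
    rcases i with _ | i <;> simp [Polynomial.coeff_one]
  | cons r s ih =>
    simp only [Multiset.map_cons, Multiset.prod_cons] at ih ⊢
    set p := (s.map fun r => Polynomial.X - Polynomial.C r).prod
    set m := Multiset.countP (fun r => ‖r‖ ≤ R) s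
    set N := ‖p.coeff m‖ * R ^ m
    have hN : 0 < N := lt_of_le_of_lt (by positivity) ((ih (m + 1)).2 (Nat.lt_succ_self m))
    have hbound (i : ℕ) : ‖((Polynomial.X - Polynomial.C r) * p).coeff (i + 1)‖ * R ^ (i + 1) ≤
        max (R * (‖p.coeff i‖ * R ^ i)) (‖r‖ * (‖p.coeff (i + 1)‖ * R ^ (i + 1))) := by
      refine (mul_le_mul_of_nonneg_right (norm_coeff_X_sub_C_mul_le p r i)
        (by positivity)).trans_eq ?_
      rw [max_mul_of_nonneg _ _ (by positivity)]
      congr 1 <;> ring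
    -- Multiplication by `X - r` moves the last maximal index up by one and scales the maximum by
    -- `R` if `‖r‖ ≤ R`. Otherwise the index stays and the maximum is scaled by `‖r‖`.
    by_cases hr : ‖r‖ ≤ R
    · rw [Multiset.countP_cons_of_pos (s := s) (p := fun r => ‖r‖ ≤ R) hr]
      have htop : ‖((Polynomial.X - Polynomial.C r) * p).coeff (m + 1)‖ * R ^ (m + 1) = R * N := by
        have hlt : ‖r * p.coeff (m + 1)‖ < ‖p.coeff m‖ := by
          have h1 := (ih (m + 1)).2 (Nat.lt_succ_self m)
          have h2 : ‖r‖ * ‖p.coeff (m + 1)‖ * R ^ m ≤ ‖p.coeff (m + 1)‖ * R ^ (m + 1) := by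
            calc ‖r‖ * ‖p.coeff (m + 1)‖ * R ^ m ≤ R * ‖p.coeff (m + 1)‖ * R ^ m := by gcongr
              _ = _ := by ring
          rw [norm_mul]
          exact lt_of_mul_lt_mul_right (h2.trans_lt h1) (by positivity)
        have heq : ‖((Polynomial.X - Polynomial.C r) * p).coeff (m + 1)‖ = ‖p.coeff m‖ := by
          rw [sub_mul, Polynomial.coeff_sub, Polynomial.coeff_X_mul, Polynomial.coeff_C_mul,
            sub_eq_add_neg, IsUltrametricDist.norm_add_eq_max_of_norm_ne_norm
              (by rw [norm_neg]; exact hlt.ne'), norm_neg, max_eq_left hlt.le]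
        rw [heq]; ring
      change ∀ i, _ ≤ ‖((Polynomial.X - Polynomial.C r) * p).coeff (m + 1)‖ * R ^ (m + 1) ∧
        (m + 1 < i → _ < ‖((Polynomial.X - Polynomial.C r) * p).coeff (m + 1)‖ * R ^ (m + 1))
      rw [htop]
      rintro (_ | i)
      · refine ⟨?_, fun h => by omega⟩
        rw [norm_coeff_zero_X_sub_C_mul]
        have := (ih 0).1
        rw [mul_assoc]
        gcongr
      · refine ⟨(hbound i).trans (max_le ?_ ?_), fun hi => (hbound i).trans_lt (max_lt ?_ ?_)⟩
        · exact mul_le_mul_of_nonneg_left (ih i).1 hR.le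
        · exact mul_le_mul hr (ih (i + 1)).1 (by positivity) hR.le
        · exact mul_lt_mul_of_pos_left ((ih i).2 (by omega)) hR
        · exact mul_lt_mul' hr ((ih (i + 1)).2 (by omega)) (by positivity) hR
    · rw [Multiset.countP_cons_of_neg (s := s) (p := fun r => ‖r‖ ≤ R) hr]
      push Not at hr
      have hr0 : 0 < ‖r‖ := hR.trans hr
      have htop : ‖((Polynomial.X - Polynomial.C r) * p).coeff m‖ * R ^ m = ‖r‖ * N := by
        rcases hm : m with _ | l
        · rw [norm_coeff_zero_X_sub_C_mul]; simp only [N, hm]; ring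
        have hlt : ‖p.coeff l‖ < ‖r * p.coeff (l + 1)‖ := by
          have h1 := (ih l).1
          have h2 : ‖p.coeff l‖ * R ^ (l + 1) < ‖r * p.coeff (l + 1)‖ * R ^ (l + 1) := by
            calc ‖p.coeff l‖ * R ^ (l + 1) = R * (‖p.coeff l‖ * R ^ l) := by ring
              _ ≤ R * N := by gcongr
              _ < ‖r‖ * N := by gcongr
              _ = _ := by simp only [N, hm, norm_mul]; ring
          exact lt_of_mul_lt_mul_right h2 (by positivity)
        have heq : ‖((Polynomial.X - Polynomial.C r) * p).coeff (l + 1)‖ =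
            ‖r‖ * ‖p.coeff (l + 1)‖ := by
          rw [sub_mul, Polynomial.coeff_sub, Polynomial.coeff_X_mul, Polynomial.coeff_C_mul,
            sub_eq_add_neg, IsUltrametricDist.norm_add_eq_max_of_norm_ne_norm
              (by rw [norm_neg]; exact hlt.ne), norm_neg, max_eq_right hlt.le, norm_mul]
        rw [heq]; simp only [N, hm]; ring
      change ∀ i, _ ≤ ‖((Polynomial.X - Polynomial.C r) * p).coeff m‖ * R ^ m ∧
        (m < i → _ < ‖((Polynomial.X - Polynomial.C r) * p).coeff m‖ * R ^ m)
      rw [htop]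
      rintro (_ | i)
      · refine ⟨?_, fun h => by omega⟩
        rw [norm_coeff_zero_X_sub_C_mul]
        have := (ih 0).1
        rw [mul_assoc]
        gcongr
      · refine ⟨(hbound i).trans (max_le ?_ ?_), fun hi => (hbound i).trans_lt (max_lt ?_ ?_)⟩
        · exact mul_le_mul hr.le (ih i).1 (by positivity) hr0.le
        · exact mul_le_mul_of_nonneg_left (ih (i + 1)).1 hr0.le
        · exact (mul_le_mul_of_nonneg_left (ih i).1 hR.le).trans_lt (mul_lt_mul_of_pos_right hr hN)
        · exact mul_lt_mul_of_pos_left ((ih (i + 1)).2 hi) hr0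

/-- If all roots of `p` have norm at least `ρ`, then the constant term dominates on the disc of
radius `ρ`. -/
lemma norm_coeff_prod_roots_le_coeff_zero (s : Multiset L) {ρ : ℝ} (hρ : 0 < ρ)
    (hs : ∀ r ∈ s, ρ ≤ ‖r‖) (i : ℕ) :
    ‖(s.map fun r => Polynomial.X - Polynomial.C r).prod.coeff i‖ * ρ ^ i ≤
      ‖(s.map fun r => Polynomial.X - Polynomial.C r).prod.coeff 0‖ := by
  induction s using Multiset.induction_on generalizing i with
  | empty => rcases i with _ | i <;> simp [Polynomial.coeff_one]
  | cons r s ih =>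
    simp only [Multiset.map_cons, Multiset.prod_cons]
    replace ih := ih fun r hr => hs r (Multiset.mem_cons_of_mem hr)
    have hr := hs r (Multiset.mem_cons_self r s)
    set p := (s.map fun r => Polynomial.X - Polynomial.C r).prod
    rcases i with _ | i
    · simp
    rw [norm_coeff_zero_X_sub_C_mul]
    refine (mul_le_mul_of_nonneg_right (norm_coeff_X_sub_C_mul_le p r i)
        (by positivity)).trans ?_
    rw [max_mul_of_nonneg _ _ (by positivity)]
    refine max_le ?_ ?_
    · calc ‖p.coeff i‖ * ρ ^ (i + 1) = ρ * (‖p.coeff i‖ * ρ ^ i) := by ring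
        _ ≤ ‖r‖ * ‖p.coeff 0‖ := mul_le_mul hr (ih i) (by positivity) (norm_nonneg _)
    · rw [mul_assoc]
      exact mul_le_mul_of_nonneg_left (ih (i + 1)) (norm_nonneg _)

end Roots

/-! ### Discs on which the lowest Taylor term dominates. -/

variable {K : Type*} [NontriviallyNormedField K] [IsUltrametricDist K]

/-- Outside of fewer than `k` discs of radius `ρ` in the disc of radius `R`, the constant term of
the Taylor expansion of `p` dominates on the disc of radius `ρ`. -/
theorem exists_finset_norm_taylor_coeff_le [CompleteSpace K] (p : Polynomial K) {k j : ℕ} {R ρ : ℝ} (hρ : 0 < ρ)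
    (hρR : ρ ≤ R) (hp : ∀ i, k ≤ i → ‖p.coeff i‖ * R ^ i < ‖p.coeff j‖ * R ^ j) :
    ∃ S : Finset K, S.card ≤ k ∧ ∀ a, ‖a‖ ≤ R → (∀ c ∈ S, ρ ≤ ‖a - c‖) →
      ∀ i, ‖(Polynomial.taylor a p).coeff i‖ * ρ ^ i ≤ ‖(Polynomial.taylor a p).coeff 0‖ := by
  classical
  have hR : 0 < R := hρ.trans_le hρR
  let L := AlgebraicClosure K
  let : NormedField L := spectralNorm.normedField K L
  have hnorm (x : L) : ‖x‖ = spectralNorm K L x := rfl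
  have : IsUltrametricDist L :=
    IsUltrametricDist.isUltrametricDist_of_isNonarchimedean_norm isNonarchimedean_spectralNorm
  have hext (x : K) : ‖algebraMap K L x‖ = ‖x‖ := spectralNorm_extends x
  set P : Polynomial L := p.map (algebraMap K L) with hP
  have hcoeff (i : ℕ) : ‖P.coeff i‖ = ‖p.coeff i‖ := by rw [hP, Polynomial.coeff_map, hext]
  have hfac : P = Polynomial.C P.leadingCoeff *
      (P.roots.map fun r => Polynomial.X - Polynomial.C r).prod :=
    (IsAlgClosed.splits P).eq_prod_roots
  have hp0 : p ≠ 0 := by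
    rintro rfl
    simpa using hp k le_rfl
  have hP0 : P ≠ 0 := by
    rw [hP]; exact (Polynomial.map_ne_zero_iff (algebraMap K L).injective).2 hp0
  have hlead : 0 < ‖P.leadingCoeff‖ := by simpa using hP0
  -- The number of roots of norm at most `R` is an index where `‖pᵢ‖ Rⁱ` is maximal, while `hp`
  -- excludes every index from `k` on.
  have hcount : Multiset.countP (fun r => ‖r‖ ≤ R) P.roots < k := by
    by_contra! hk
    have h1 := (norm_coeff_prod_roots_le P.roots hR j).1
    have h2 := hp _ hk
    simp only [← hcoeff] at h2
    rw [hfac] at h2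
    simp only [Polynomial.coeff_C_mul, norm_mul, mul_assoc] at h2
    have h3 := lt_of_mul_lt_mul_left h2 hlead.le
    rw [← hfac] at h3
    exact absurd h1 (not_le.2 h3)
  -- Roots lie in the algebraic closure, but the centres must lie in `K`. Any point of `K` within
  -- `ρ` of the root excludes the same points of `K`. If there is none, the default `0` only
  -- excludes a superfluous disc.
  let c : L → K := fun r => if h : ∃ c : K, ‖algebraMap K L c - r‖ < ρ then h.choose else 0
  have hc (r : L) (a : K) (h : ‖algebraMap K L a - r‖ < ρ) : ‖a - c r‖ < ρ := by
    have hex : ∃ c : K, ‖algebraMap K L c - r‖ < ρ := ⟨a, h⟩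
    have hcr : ‖algebraMap K L (c r) - r‖ < ρ := by
      simp only [c, dif_pos hex]
      exact hex.choose_spec
    rw [← hext, map_sub, ← sub_sub_sub_cancel_right _ _ r]
    exact (norm_sub_le_max_norm _ _).trans_lt (max_lt h hcr)
  refine ⟨((P.roots.filter fun r => ‖r‖ ≤ R).map c).toFinset, ?_, ?_⟩
  · refine (Multiset.toFinset_card_le _).trans ?_
    rw [Multiset.card_map, ← Multiset.countP_eq_card_filter]
    exact hcount.le
  intro a ha hS i
  have hroots : ∀ r ∈ P.roots, ρ ≤ ‖r - algebraMap K L a‖ := by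
    intro r hr
    rw [norm_sub_rev]
    by_contra! hlt
    by_cases hrR : ‖r‖ ≤ R
    · refine absurd (hc r a hlt) (not_lt.2 (hS _ ?_))
      rw [Multiset.mem_toFinset]
      exact Multiset.mem_map_of_mem _ (Multiset.mem_filter.2 ⟨hr, hrR⟩)
    · push Not at hrR
      have h1 : ‖r‖ ≤ max ‖algebraMap K L a - (algebraMap K L a - r)‖ 0 := by simp
      have h2 := norm_sub_le_max_norm (algebraMap K L a) (algebraMap K L a - r)
      rw [sub_sub_cancel, hext] at h2
      exact absurd (h2.trans (max_le ha (hlt.le.trans hρR))) (not_le.2 hrR)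
  have htay : (Polynomial.taylor a p).map (algebraMap K L) = Polynomial.C P.leadingCoeff *
      ((P.roots.map fun r => r - algebraMap K L a).map
        fun r => Polynomial.X - Polynomial.C r).prod := by
    have h1 : (Polynomial.taylor a p).map (algebraMap K L) =
        Polynomial.taylor (algebraMap K L a) P := by
      rw [Polynomial.taylor_apply, Polynomial.taylor_apply, Polynomial.map_comp]
      simp [hP]
    rw [h1]
    conv_lhs => rw [hfac]
    rw [Polynomial.taylor_mul, Polynomial.taylor_C]
    congr 1
    rw [← Polynomial.taylorAlgHom_apply, map_multiset_prod, Multiset.map_map, Multiset.map_map]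
    congr 1
    refine Multiset.map_congr rfl fun r _ => ?_
    simp
    ring
  have hT (i : ℕ) : ‖(Polynomial.taylor a p).coeff i‖ = ‖P.leadingCoeff‖ *
      ‖((P.roots.map fun r => r - algebraMap K L a).map
        fun r => Polynomial.X - Polynomial.C r).prod.coeff i‖ := by
    rw [← norm_mul, ← Polynomial.coeff_C_mul, ← htay, Polynomial.coeff_map, hext]
  rw [hT, hT, mul_assoc]
  refine mul_le_mul_of_nonneg_left (norm_coeff_prod_roots_le_coeff_zero _ hρ ?_ i) hlead.le
  intro r hr
  obtain ⟨r', hr', rfl⟩ := Multiset.mem_map.1 hr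
  exact hroots r' hr'

/-- Differentiation multiplies coefficients by integers `i ≤ k`. The number `|k!|` is a common lower
bound for their norms. -/
lemma norm_factorial_le_norm_natCast {i k : ℕ} (hi : 1 ≤ i) (hik : i ≤ k) :
    ‖((k.factorial : ℕ) : K)‖ ≤ ‖((i : ℕ) : K)‖ := by
  obtain ⟨m, hm⟩ := Nat.dvd_factorial hi hik
  rw [hm, Nat.cast_mul, norm_mul]
  exact mul_le_of_le_one_right (norm_nonneg _) (IsUltrametricDist.norm_natCast_le_one K m)

/-- Outside of few discs, the linear term of the Taylor expansion dominates. -/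
theorem exists_finset_linear_term_dominates [CompleteSpace K] (h : Polynomial K) {k j : ℕ} {M R ρ : ℝ}
    (hM : 1 ≤ M) (hρ : 0 < ρ) (hρR : ρ ≤ R) (hR1 : R ≤ 1)
    (hMR : M * R < ‖((k.factorial : ℕ) : K)‖) (hj : 1 ≤ j) (hjk : j ≤ k)
    (hupper : ∀ a, ‖a‖ ≤ R → ∀ i, 1 ≤ i → ‖(Polynomial.taylor a h).coeff i‖ ≤ M)
    (hlower : ∀ a, ‖a‖ ≤ R → 1 ≤ ‖(Polynomial.taylor a h).coeff j‖) :
    ∃ S : Finset K, S.card ≤ k ∧ ∀ a, ‖a‖ ≤ R → (∀ c ∈ S, ρ ≤ ‖a - c‖) →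
      ‖((k.factorial : ℕ) : K)‖ * ρ ^ (k - 1) ≤ ‖(Polynomial.taylor a h).coeff 1‖ ∧
      ∀ i, 2 ≤ i → ‖(Polynomial.taylor a h).coeff i‖ * (R * ρ) ^ (i - 1) <
        ‖(Polynomial.taylor a h).coeff 1‖ := by
  have hR : 0 < R := hρ.trans_le hρR
  have hρ1 : ρ ≤ 1 := hρR.trans hR1
  set κ := ‖((k.factorial : ℕ) : K)‖
  have hκ : 0 < κ := lt_of_le_of_lt (by positivity) hMR
  have hRκ : R < κ := lt_of_le_of_lt (le_mul_of_one_le_left hR.le hM) hMR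
  have hder (a : K) (i : ℕ) : (Polynomial.taylor a (Polynomial.derivative h)).coeff i =
      (Polynomial.taylor a h).coeff (i + 1) * ((i + 1 : ℕ) : K) := by
    have : Polynomial.taylor a (Polynomial.derivative h) =
        Polynomial.derivative (Polynomial.taylor a h) := by
      simp [Polynomial.taylor_apply, Polynomial.derivative_comp]
    rw [this, Polynomial.coeff_derivative]
    push_cast
    rfl
  -- Applied to `h'`: its coefficients of index `i ≥ k` contribute at most `M R^k < |k!| R^(k-1)`,
  -- while the one of index `j - 1` contributes at least `|j| R^(j-1)`, which is no smaller than the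
  -- latter.
  obtain ⟨S, hS, hS'⟩ := exists_finset_norm_taylor_coeff_le (Polynomial.derivative h)
    (k := k) (j := j - 1) hρ hρR (by
      intro i hi
      have h1 := hder 0 i
      have h2 := hder 0 (j - 1)
      rw [Polynomial.taylor_zero] at h1 h2
      rw [h1, h2, norm_mul, norm_mul, Nat.sub_add_cancel hj]
      have h0 : ‖(0 : K)‖ ≤ R := by simpa using hR.le
      calc _ ≤ M * 1 * R ^ (k - 1 + 1) := by
            rw [Nat.sub_add_cancel (hj.trans hjk)]
            gcongr ?_ * ?_ * ?_
            · exact hupper 0 h0 _ (by omega)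
            · exact IsUltrametricDist.norm_natCast_le_one K _
            · exact pow_le_pow_of_le_one hR.le hR1 hi
        _ = M * R * R ^ (k - 1) := by ring
        _ < κ * R ^ (k - 1) := by gcongr
        _ ≤ 1 * ‖((j : ℕ) : K)‖ * R ^ (j - 1) := by
            rw [one_mul]
            gcongr ?_ * ?_
            · exact norm_factorial_le_norm_natCast hj hjk
            · exact pow_le_pow_of_le_one hR.le hR1 (by omega)
        _ ≤ _ := by
            gcongr
            exact hlower 0 h0)
  refine ⟨S, hS, fun a ha hc => ?_⟩
  have hdom := hS' a ha hc
  have h0 : ‖(Polynomial.taylor a (Polynomial.derivative h)).coeff 0‖ =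
      ‖(Polynomial.taylor a h).coeff 1‖ := by
    rw [hder]; simp
  have hlow : κ * ρ ^ (k - 1) ≤ ‖(Polynomial.taylor a h).coeff 1‖ := by
    have h1 := hdom (j - 1)
    rw [h0, hder, Nat.sub_add_cancel hj, norm_mul] at h1
    refine le_trans ?_ h1
    calc κ * ρ ^ (k - 1) ≤ 1 * ‖((j : ℕ) : K)‖ * ρ ^ (j - 1) := by
          rw [one_mul]
          gcongr ?_ * ?_
          · exact norm_factorial_le_norm_natCast hj hjk
          · exact pow_le_pow_of_le_one hρ.le hρ1 (by omega)
      _ ≤ _ := by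
          gcongr
          exact hlower a ha
  have hpos : 0 < ‖(Polynomial.taylor a h).coeff 1‖ := lt_of_lt_of_le (by positivity) hlow
  refine ⟨hlow, fun i hi => ?_⟩
  have hRpow : (R * ρ) ^ (i - 1) ≤ R * ρ ^ (i - 1) := by
    rw [mul_pow]
    gcongr
    exact pow_le_of_le_one hR.le hR1 (by omega)
  -- For `i > k` the coefficient bound `M` and the small factor `R` suffice. For `i ≤ k`, dividing
  -- by `i` loses at most `1/|k!|`, which is repaired by `R < |k!|`. This is why the dominance is
  -- claimed at radius `R * ρ` and not at `ρ`.
  rcases Nat.lt_or_ge k i with hki | hik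
  · calc _ ≤ M * (R * ρ ^ (k - 1)) := by
          gcongr ?_ * ?_
          · exact hupper a ha i (by omega)
          · refine hRpow.trans ?_
            gcongr ?_ * ?_
            exact pow_le_pow_of_le_one hρ.le hρ1 (by omega)
      _ = M * R * ρ ^ (k - 1) := by ring
      _ < κ * ρ ^ (k - 1) := by gcongr
      _ ≤ _ := hlow
  · have h1 := hdom (i - 1)
    rw [h0, hder, Nat.sub_add_cancel (by omega), norm_mul] at h1
    have hκi : κ ≤ ‖((i : ℕ) : K)‖ := norm_factorial_le_norm_natCast (by omega) hik
    have h2 : ‖(Polynomial.taylor a h).coeff i‖ * κ * ρ ^ (i - 1) ≤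
        ‖(Polynomial.taylor a h).coeff 1‖ := le_trans (by gcongr) h1
    have h3 : κ * (‖(Polynomial.taylor a h).coeff i‖ * (R * ρ) ^ (i - 1)) <
        κ * ‖(Polynomial.taylor a h).coeff 1‖ := by
      calc _ ≤ κ * (‖(Polynomial.taylor a h).coeff i‖ * (R * ρ ^ (i - 1))) := by gcongr
        _ = R * (‖(Polynomial.taylor a h).coeff i‖ * κ * ρ ^ (i - 1)) := by ring
        _ ≤ R * ‖(Polynomial.taylor a h).coeff 1‖ := by gcongr
        _ < _ := by gcongr
    exact lt_of_mul_lt_mul_left h3 hκ.le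

/-! ### Averaging over translations. -/

section Average

/-- Averaging over translations that preserve `S`. -/
theorem norm_setIntegral_le_of_average {G W : Type*} [AddCommGroup G] [TopologicalSpace G]
    [IsTopologicalAddGroup G] [MeasurableSpace G] [BorelSpace G] [SecondCountableTopology G]
    [TopologicalSpace W] [MeasurableSpace W] [BorelSpace W] [SecondCountableTopology W]
    (μ : Measure G) [μ.IsAddLeftInvariant] [SFinite μ] (ν : Measure W) [IsProbabilityMeasure ν]
    {F : G → ℂ} (hF : Continuous F) (hF1 : ∀ x, ‖F x‖ ≤ 1) {c : W → G} (hc : Continuous c)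
    {S : Set G} (hS : MeasurableSet S) (hμS : μ S ≠ ⊤)
    (hinv : ∀ᵐ w ∂ν, ∀ x, x + c w ∈ S ↔ x ∈ S) {B : ℝ}
    (hB : ∀ x ∈ S, ‖∫ w, F (x + c w) ∂ν‖ ≤ B) :
    ‖∫ x in S, F x ∂μ‖ ≤ B * μ.real S := by
  have : IsFiniteMeasure (μ.restrict S) := ⟨by simpa using hμS.lt_top⟩
  have htrans : ∀ᵐ w ∂ν, ∫ x in S, F x ∂μ = ∫ x in S, F (x + c w) ∂μ := by
    filter_upwards [hinv] with w hw
    rw [← integral_indicator hS, ← integral_indicator hS,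
      ← integral_add_right_eq_self _ (c w)]
    refine integral_congr_ae (.of_forall fun x => ?_)
    by_cases hx : x ∈ S
    · simp only [Set.indicator_of_mem hx, Set.indicator_of_mem ((hw x).2 hx)]
    · simp only [Set.indicator_of_notMem hx, Set.indicator_of_notMem (mt (hw x).1 hx)]
  have hint : Integrable (Function.uncurry fun x w => F (x + c w)) ((μ.restrict S).prod ν) := by
    refine (integrable_const (1 : ℝ)).mono' ?_ (.of_forall fun _ => hF1 _)
    refine Continuous.aestronglyMeasurable ?_
    exact hF.comp (continuous_fst.add (hc.comp continuous_snd))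
  have h1 : ∫ x in S, F x ∂μ = ∫ x in S, ∫ w, F (x + c w) ∂ν ∂μ := by
    rw [integral_integral_swap hint, ← integral_congr_ae htrans]
    simp
  rw [h1]
  exact norm_setIntegral_le_of_norm_le_const hμS.lt_top hB

end Average

/-! ### Haar measure and orthogonality of characters. -/

section Haar

variable {K : Type*} [NontriviallyNormedField K]

lemma continuous_addChar {ψ : AddChar K Circle} (hψ : ∀ a : K, ‖a‖ < 1 → ψ a = 1) :
    Continuous ψ := by
  have hlc : IsLocallyConstant ψ := by
    rw [IsLocallyConstant.iff_eventually_eq]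
    intro x
    filter_upwards [Metric.ball_mem_nhds x one_pos] with y hy
    rw [mem_ball_iff_norm] at hy
    have := hψ _ hy
    rwa [AddChar.map_sub_eq_div, div_eq_one] at this
  exact hlc.continuous

section Measure

variable [LocallyCompactSpace K] [MeasurableSpace K] [BorelSpace K]

instance : (haar K).IsAddHaarMeasure := by unfold haar; infer_instance

lemma haar_closedBall_one (a : K) : haar K (Metric.closedBall a 1) = 1 := by
  rw [show Metric.closedBall a 1 = (fun x => -a + x) ⁻¹' Metric.closedBall 0 1 by
    ext x; simp [dist_eq_norm, neg_add_eq_sub], measure_preimage_add]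
  exact Measure.addHaarMeasure_self (K₀ := unitBall K)

variable (K) in
/-- The normalized Haar measure on the valuation ring. -/
noncomputable def unitHaar : Measure K := (haar K).restrict (Metric.closedBall 0 1)

instance : IsProbabilityMeasure (unitHaar K) :=
  ⟨by simp [unitHaar, haar_closedBall_one]⟩

lemma ae_unitHaar : ∀ᵐ t ∂(unitHaar K), ‖t‖ ≤ 1 := by
  filter_upwards [ae_restrict_mem Metric.isClosed_closedBall.measurableSet] with t ht
  simpa using ht

end Measure

variable [IsUltrametricDist K]

lemma add_mem_closedBall_iff {w : K} (hw : ‖w‖ ≤ 1) (x : K) :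
    x + w ∈ Metric.closedBall (0 : K) 1 ↔ x ∈ Metric.closedBall (0 : K) 1 := by
  simp only [mem_closedBall_zero_iff]
  constructor <;> intro h
  · simpa using (norm_sub_le_max_norm (x + w) w).trans (max_le h hw)
  · exact (IsUltrametricDist.norm_add_le_max x w).trans (max_le h hw)

variable [LocallyCompactSpace K]

/-- A normalized local field has a uniformizer of norm `1 / q`. -/
lemma exists_uniformizer (hK : IsNormalized K) :
    2 ≤ residueCard K ∧ ∃ ϖ : K, ‖ϖ‖ = (residueCard K : ℝ)⁻¹ := by
  have : ProperSpace K := ProperSpace.of_locallyCompactSpace K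
  let : Valued K NNReal := NormedField.toValued
  have hcomp : CompactSpace (integers K) := by
    rw [← isCompact_univ_iff, Subtype.isCompact_iff]
    have : ((↑) '' (Set.univ : Set (integers K)) : Set K) = Metric.closedBall 0 1 := by
      ext x
      simp [integers, Valuation.mem_integer_iff, ← NNReal.coe_le_coe]
    rw [this]
    exact isCompact_closedBall 0 1
  have hnt : (Valued.v : Valuation K NNReal).IsNontrivial :=
    inferInstanceAs (NormedField.valuation (K := K)).IsNontrivial
  have hc : CompactSpace (Valued.integer K) := hcomp
  have hd : IsDiscreteValuationRing (Valued.integer K) :=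
    Valued.integer.isDiscreteValuationRing_of_compactSpace
  have hd' : IsDiscreteValuationRing (integers K) := hd
  obtain ⟨ϖ, hϖ⟩ := IsDiscreteValuationRing.exists_irreducible (integers K)
  have h1 := hK ϖ hϖ
  have hpos : (ϖ : K) ≠ 0 := by simpa using hϖ.ne_zero
  have hlt : ‖(ϖ : K)‖ < 1 := Valued.integer.norm_irreducible_lt_one hϖ
  refine ⟨?_, ϖ, h1⟩
  rw [h1] at hlt
  have hne : (residueCard K : ℝ) ≠ 0 := by
    intro h
    rw [h, inv_zero, norm_eq_zero] at h1
    exact hpos h1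
  by_contra! h
  have : residueCard K = 0 ∨ residueCard K = 1 := by omega
  rcases this with h | h <;> simp [h] at hlt hne

/-- Representatives of the residue classes. -/
lemma exists_residue_representatives (hK : IsNormalized K) :
    ∃ a : Fin (residueCard K) → K, (∀ i, ‖a i‖ ≤ 1) ∧ ∀ i j, i ≠ j → ‖a i - a j‖ = 1 := by
  have h2 := (exists_uniformizer hK).1
  have hfin : Finite (IsLocalRing.ResidueField (integers K)) :=
    Nat.finite_of_card_ne_zero (by change residueCard K ≠ 0; omega)
  let e : Fin (residueCard K) ≃ IsLocalRing.ResidueField (integers K) :=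
    (Finite.equivFin _).symm
  choose b hb using IsLocalRing.residue_surjective (R := integers K)
  have hmem (x : integers K) : ‖(x : K)‖ ≤ 1 := x.2
  refine ⟨fun i => (b (e i) : K), fun i => hmem _, fun i j hij => ?_⟩
  have hunit : IsUnit (b (e i) - b (e j)) := by
    rw [← IsLocalRing.residue_ne_zero_iff_isUnit, map_sub, hb, hb, sub_ne_zero]
    exact e.injective.ne hij
  have := (Valuation.integer.integers
    (NormedField.valuation (K := K))).isUnit_iff_valuation_eq_one.1 hunit
  simpa [← NNReal.coe_inj] using! this

variable [MeasurableSpace K] [BorelSpace K]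

/-- A ball of radius `‖ϖ‖ ^ m` contains `q` disjoint translates of the next smaller one, centred at
multiples by `ϖ ^ m` of representatives of the residue classes. Normalization, `‖ϖ‖ = 1/q`, makes
radius and measure match. -/
lemma haar_closedBall_le (hK : IsNormalized K) {ϖ : K} (hϖ : ‖ϖ‖ = (residueCard K : ℝ)⁻¹)
    (a : K) (m : ℕ) : haar K (Metric.closedBall a (‖ϖ‖ ^ m)) ≤ ENNReal.ofReal (‖ϖ‖ ^ m) := by
  have : ProperSpace K := ProperSpace.of_locallyCompactSpace K
  obtain ⟨hq, -⟩ := exists_uniformizer hK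
  have hq0 : (0 : ℝ) < residueCard K := by positivity
  have hϖ0 : 0 < ‖ϖ‖ := by rw [hϖ]; positivity
  have hϖ1 : ‖ϖ‖ < 1 := by
    rw [hϖ]; exact inv_lt_one_of_one_lt₀ (by exact_mod_cast hq)
  obtain ⟨b, hb1, hb⟩ := exists_residue_representatives hK
  have htrans (c : K) (r : ℝ) :
      haar K (Metric.closedBall c r) = haar K (Metric.closedBall 0 r) := by
    rw [show Metric.closedBall c r = (fun x => -c + x) ⁻¹' Metric.closedBall 0 r by
      ext x; simp [dist_eq_norm, neg_add_eq_sub], measure_preimage_add]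
  rw [htrans]
  induction m with
  | zero => simp [haar_closedBall_one]
  | succ m ih =>
    have hsub : (⋃ i, Metric.closedBall (b i * ϖ ^ m) (‖ϖ‖ ^ (m + 1))) ⊆
        Metric.closedBall 0 (‖ϖ‖ ^ m) := by
      refine Set.iUnion_subset fun i x hx => ?_
      rw [mem_closedBall_zero_iff]
      rw [mem_closedBall_iff_norm] at hx
      have h1 := IsUltrametricDist.norm_add_le_max (x - b i * ϖ ^ m) (b i * ϖ ^ m)
      rw [sub_add_cancel] at h1
      refine h1.trans (max_le (hx.trans ?_) ?_)
      · exact pow_le_pow_of_le_one hϖ0.le hϖ1.le (Nat.le_succ m)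
      · rw [norm_mul, norm_pow]
        exact mul_le_of_le_one_left (by positivity) (hb1 i)
    have hdisj : Pairwise (Function.onFun Disjoint
        fun i => Metric.closedBall (b i * ϖ ^ m) (‖ϖ‖ ^ (m + 1))) := by
      intro i j hij
      refine Set.disjoint_left.2 fun x hi hj => ?_
      rw [mem_closedBall_iff_norm] at hi hj
      have h1 := norm_sub_le_max_norm (x - b j * ϖ ^ m) (x - b i * ϖ ^ m)
      rw [sub_sub_sub_cancel_left, ← sub_mul, norm_mul, hb i j hij, one_mul, norm_pow] at h1
      have h2 : ‖ϖ‖ ^ (m + 1) < ‖ϖ‖ ^ m := pow_lt_pow_right_of_lt_one₀ hϖ0 hϖ1 (Nat.lt_succ_self m)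
      exact absurd (h1.trans (max_le hj hi)) (not_le.2 h2)
    have hle := measure_mono (μ := haar K) hsub
    rw [measure_iUnion hdisj fun i => Metric.isClosed_closedBall.measurableSet] at hle
    simp only [htrans, tsum_fintype, Finset.sum_const, Finset.card_univ, Fintype.card_fin] at hle
    have hle2 := hle.trans ih
    rw [nsmul_eq_mul] at hle2
    have hϖq : ‖ϖ‖ ^ (m + 1) = (residueCard K : ℝ)⁻¹ * ‖ϖ‖ ^ m := by rw [pow_succ', hϖ]
    rw [hϖq, ENNReal.ofReal_mul (by positivity), ENNReal.ofReal_inv_of_pos hq0,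
      ENNReal.ofReal_natCast]
    rw [← hϖq, mul_comm, ← div_eq_mul_inv,
      ENNReal.le_div_iff_mul_le (Or.inl (by simp; omega)) (Or.inl (by simp)), mul_comm]
    exact hle2

/-- Translation by `u⁻¹ a` preserves the unit ball and multiplies the integral by `ψ a ≠ 1`. -/
lemma integral_addChar_eq_zero {ψ : AddChar K Circle}
    (hψ1 : ∃ a : K, ‖a‖ ≤ 1 ∧ ψ a ≠ 1) {u : K} (hu : ‖u‖ = 1) :
    ∫ t, ((ψ (u * t) : Circle) : ℂ) ∂(unitHaar K) = 0 := by
  obtain ⟨a, ha, hψa⟩ := hψ1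
  have hu0 : u ≠ 0 := by rintro rfl; simp at hu
  set b := u⁻¹ * a
  have hb : ‖b‖ ≤ 1 := by simp [b, hu, ha]
  have hub : u * b = a := by simp [b, hu0]
  have hS : MeasurableSet (Metric.closedBall (0 : K) 1) := Metric.isClosed_closedBall.measurableSet
  have key : ∫ t, ((ψ (u * t) : Circle) : ℂ) ∂(unitHaar K) =
      ∫ t, ((ψ (u * (t + b)) : Circle) : ℂ) ∂(unitHaar K) := by
    rw [unitHaar, ← integral_indicator hS, ← integral_indicator hS,
      ← integral_add_right_eq_self _ b]
    refine integral_congr_ae (.of_forall fun x => ?_)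
    by_cases hx : x ∈ Metric.closedBall (0 : K) 1
    · simp only [Set.indicator_of_mem hx, Set.indicator_of_mem ((add_mem_closedBall_iff hb x).2 hx)]
    · simp only [Set.indicator_of_notMem hx,
        Set.indicator_of_notMem (mt (add_mem_closedBall_iff hb x).1 hx)]
  simp only [mul_add, hub, AddChar.map_add_eq_mul, Circle.coe_mul] at key
  rw [integral_mul_const] at key
  have h1 : (∫ t, ((ψ (u * t) : Circle) : ℂ) ∂(unitHaar K)) * (1 - (ψ a : ℂ)) = 0 := by
    rw [mul_sub, mul_one, ← key, sub_self]
  refine (mul_eq_zero.1 h1).resolve_right ?_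
  intro h
  exact hψa (Circle.ext (sub_eq_zero.1 h).symm)

end Haar

/-! ### Vanishing on good discs and the one-variable estimate. -/

section Ultrametric

variable {K : Type*} [NormedField K] [IsUltrametricDist K]

lemma norm_sum_lt_of_forall_lt {ι E : Type*} [SeminormedAddCommGroup E] [IsUltrametricDist E]
    (s : Finset ι) {f : ι → E} {C : ℝ} (hC : 0 < C) (h : ∀ i ∈ s, ‖f i‖ < C) :
    ‖∑ i ∈ s, f i‖ < C := by
  classical
  induction s using Finset.induction_on with
  | empty => simpa using hC
  | insert a s ha ih =>
    rw [Finset.sum_insert ha]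
    exact (IsUltrametricDist.norm_add_le_max _ _).trans_lt (max_lt (h a (by simp))
      (ih fun i hi => h i (Finset.mem_insert_of_mem hi)))

lemma norm_eval_sub_coeff_zero_lt (p : Polynomial K) (b : K) {C : ℝ} (hC : 0 < C)
    (h : ∀ i, 1 ≤ i → ‖p.coeff i‖ * ‖b‖ ^ i < C) : ‖p.eval b - p.coeff 0‖ < C := by
  rw [Polynomial.eval_eq_sum_range' (n := p.natDegree + 1) (by omega), Finset.sum_range_succ']
  simp only [pow_zero, mul_one, add_sub_cancel_right]
  refine norm_sum_lt_of_forall_lt _ hC fun i _ => ?_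
  rw [norm_mul, norm_pow]
  exact h _ (by omega)

lemma norm_eval_sub_linear_lt (p : Polynomial K) (b : K) {C : ℝ} (hC : 0 < C)
    (h : ∀ i, 2 ≤ i → ‖p.coeff i‖ * ‖b‖ ^ i < C) :
    ‖p.eval b - (p.coeff 0 + p.coeff 1 * b)‖ < C := by
  rw [Polynomial.eval_eq_sum_range' (n := p.natDegree + 1 + 1) (by omega),
    Finset.sum_range_succ', Finset.sum_range_succ']
  simp only [pow_zero, mul_one, zero_add, pow_one]
  rw [add_assoc, add_comm (p.coeff 1 * b), add_sub_cancel_right]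
  refine norm_sum_lt_of_forall_lt _ hC fun i _ => ?_
  rw [norm_mul, norm_pow]
  exact h _ (by omega)

lemma norm_eq_of_norm_sub_lt {x y : K} (h : ‖x - y‖ < ‖y‖) : ‖x‖ = ‖y‖ := by
  have := IsUltrametricDist.norm_add_eq_max_of_norm_ne_norm h.ne
  rwa [sub_add_cancel, max_eq_right h.le] at this

end Ultrametric

variable {K : Type*} [NontriviallyNormedField K] [IsUltrametricDist K] [LocallyCompactSpace K]
  [MeasurableSpace K] [BorelSpace K]

/-- A disc on which the phase is linear contributes nothing. -/
lemma integral_eq_zero_of_linear_phase {ψ : AddChar K Circle} (hψ : ∀ a : K, ‖a‖ < 1 → ψ a = 1)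
    (hψ1 : ∃ a : K, ‖a‖ ≤ 1 ∧ ψ a ≠ 1) (h : Polynomial K) (a e lam : K)
    (h1 : ‖lam * (Polynomial.taylor a h).coeff 1 * e‖ = 1)
    (h2 : ∀ i, 2 ≤ i → ‖lam‖ * ‖(Polynomial.taylor a h).coeff i‖ * ‖e‖ ^ i < 1) :
    ∫ u, ((ψ (lam * h.eval (a + e * u)) : Circle) : ℂ) ∂(unitHaar K) = 0 := by
  set p := Polynomial.taylor a h with hp
  have hlam : 0 < ‖lam‖ := norm_pos_iff.2 fun h0 => by simp [h0] at h1
  have key : ∀ᵐ u ∂(unitHaar K), ((ψ (lam * h.eval (a + e * u)) : Circle) : ℂ) =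
      (ψ (lam * p.coeff 0) : ℂ) * (ψ (lam * p.coeff 1 * e * u) : ℂ) := by
    filter_upwards [ae_unitHaar] with u hu
    have h3 := norm_eval_sub_linear_lt p (e * u) (C := ‖lam‖⁻¹) (by positivity) (fun i hi => by
      rw [← one_div, lt_div_iff₀' hlam]
      refine lt_of_le_of_lt ?_ (h2 i hi)
      have h3 : ‖e * u‖ ≤ ‖e‖ := by
        rw [norm_mul]; exact mul_le_of_le_one_right (norm_nonneg _) hu
      rw [← mul_assoc]
      gcongr)
    have h4 : ‖lam * (p.eval (e * u) - (p.coeff 0 + p.coeff 1 * (e * u)))‖ < 1 := by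
      rw [norm_mul]
      calc _ < ‖lam‖ * ‖lam‖⁻¹ := by gcongr
        _ = 1 := mul_inv_cancel₀ hlam.ne'
    have h5 := hψ _ h4
    have h6 : lam * h.eval (a + e * u) = lam * (p.eval (e * u) - (p.coeff 0 + p.coeff 1 * (e * u)))
        + (lam * p.coeff 0 + lam * p.coeff 1 * e * u) := by
      rw [hp, Polynomial.taylor_eval, add_comm (e * u)]
      ring
    rw [h6, AddChar.map_add_eq_mul, h5, one_mul, AddChar.map_add_eq_mul, Circle.coe_mul]
  rw [integral_congr_ae key, integral_const_mul, integral_addChar_eq_zero hψ1 h1, mul_zero]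

/-- A disc on which the linear term dominates contributes nothing. -/
lemma integral_eq_zero_of_linear_term_dominates {ψ : AddChar K Circle}
    (hψ : ∀ a : K, ‖a‖ < 1 → ψ a = 1) (hψ1 : ∃ a : K, ‖a‖ ≤ 1 ∧ ψ a ≠ 1) (h : Polynomial K)
    (a g lam : K) (hg : g ≠ 0)
    (hdom : ∀ b, ‖b‖ ≤ ‖g‖ → ∀ i, 2 ≤ i → ‖(Polynomial.taylor (a + b) h).coeff i‖ * ‖g‖ ^ (i - 1) <
      ‖(Polynomial.taylor (a + b) h).coeff 1‖)
    (hlarge : 1 ≤ ‖lam‖ * ‖(Polynomial.taylor a h).coeff 1‖ * ‖g‖) :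
    ∫ w, ((ψ (lam * h.eval (a + g * w)) : Circle) : ℂ) ∂(unitHaar K) = 0 := by
  have : ProperSpace K := ProperSpace.of_locallyCompactSpace K
  have hg0 : 0 < ‖g‖ := norm_pos_iff.2 hg
  set p := Polynomial.taylor a h with hp
  have hprod : 0 < ‖lam‖ * ‖p.coeff 1‖ * ‖g‖ := one_pos.trans_le hlarge
  have hlam : 0 < ‖lam‖ := by
    by_contra hcon
    have h0 : ‖lam‖ = 0 := le_antisymm (not_lt.1 hcon) (norm_nonneg _)
    simp [h0] at hprod
  have hp1 : 0 < ‖p.coeff 1‖ := by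
    by_contra hcon
    have h0 : ‖p.coeff 1‖ = 0 := le_antisymm (not_lt.1 hcon) (norm_nonneg _)
    simp [h0] at hprod
  -- The derivative has constant norm on the disc, because its own constant term dominates there.
  -- One radius `‖e‖` therefore serves for all subdiscs.
  have hconst (b : K) (hb : ‖b‖ ≤ ‖g‖) :
      ‖(Polynomial.taylor (a + b) h).coeff 1‖ = ‖p.coeff 1‖ := by
    have h1 : (Polynomial.taylor (a + b) h).coeff 1 = (Polynomial.derivative p).eval b := by
      rw [Polynomial.taylor_coeff_one, hp]
      simp [Polynomial.taylor_apply, Polynomial.derivative_comp, add_comm]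
    have h2 : (Polynomial.derivative p).coeff 0 = p.coeff 1 := by
      simp [Polynomial.coeff_derivative]
    rw [h1, ← h2]
    refine norm_eq_of_norm_sub_lt
      (norm_eval_sub_coeff_zero_lt _ b (by rw [h2]; exact hp1) fun i hi => ?_)
    rw [h2, Polynomial.coeff_derivative, norm_mul]
    have h3 := hdom 0 (by simp) (i + 1) (by omega)
    rw [add_zero, ← hp, Nat.add_sub_cancel] at h3
    refine lt_of_le_of_lt ?_ h3
    have h4 : ‖((i : K) + 1)‖ ≤ 1 := by
      simpa using IsUltrametricDist.norm_natCast_le_one K (i + 1)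
    calc _ ≤ ‖p.coeff (i + 1)‖ * 1 * ‖g‖ ^ i := by gcongr
      _ = _ := by ring
  -- On subdiscs of this radius, contained in the disc by `hlarge`, the linear phase has a
  -- coefficient of norm exactly `1` and all higher terms fall into the kernel of `ψ`.
  set e := (lam * p.coeff 1)⁻¹ with he
  have hen : ‖e‖ = (‖lam‖ * ‖p.coeff 1‖)⁻¹ := by rw [he, norm_inv, norm_mul]
  have heg : ‖e‖ ≤ ‖g‖ := by
    rw [hen, inv_le_iff_one_le_mul₀ (by positivity), mul_comm]
    exact hlarge
  have hF : Continuous fun w => ((ψ (lam * h.eval (a + g * w)) : Circle) : ℂ) := by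
    have := continuous_addChar hψ
    have := h.continuous
    fun_prop
  have hc : Continuous fun u : K => g⁻¹ * e * u := by fun_prop
  have hcn (u : K) (hu : ‖u‖ ≤ 1) : ‖g⁻¹ * e * u‖ ≤ 1 := by
    rw [norm_mul, norm_mul, norm_inv]
    have : ‖g‖⁻¹ * ‖e‖ ≤ 1 := by
      rw [inv_mul_le_iff₀ hg0, mul_one]; exact heg
    calc _ ≤ (1 : ℝ) * 1 := by gcongr
      _ = 1 := one_mul 1
  have key := norm_setIntegral_le_of_average (haar K) (unitHaar K) hF
    (fun x => (Circle.norm_coe _).le) hc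
    (S := Metric.closedBall 0 1) Metric.isClosed_closedBall.measurableSet
    (by rw [haar_closedBall_one]; simp)
    (by
      filter_upwards [ae_unitHaar] with u hu x
      exact add_mem_closedBall_iff (hcn u hu) x) (B := 0) (by
      intro w hw
      rw [mem_closedBall_zero_iff] at hw
      have hb : ‖g * w‖ ≤ ‖g‖ := by
        rw [norm_mul]; exact mul_le_of_le_one_right hg0.le hw
      have h0 := integral_eq_zero_of_linear_phase hψ hψ1 h (a + g * w) e lam (by
        rw [norm_mul, norm_mul, hconst _ hb, hen, mul_inv_cancel₀ (by positivity)]) (by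
        intro i hi
        have h1 := hdom _ hb i hi
        rw [hconst _ hb] at h1
        obtain ⟨i, rfl⟩ : ∃ l, i = l + 1 := ⟨i - 1, by omega⟩
        rw [Nat.add_sub_cancel] at h1
        have he0 : 0 < ‖e‖ := by rw [hen]; positivity
        calc _ = ‖lam‖ * ‖e‖ * (‖(Polynomial.taylor (a + g * w) h).coeff (i + 1)‖ * ‖e‖ ^ i) := by
              ring
          _ ≤ ‖lam‖ * ‖e‖ * (‖(Polynomial.taylor (a + g * w) h).coeff (i + 1)‖ * ‖g‖ ^ i) := by
              gcongr
          _ < ‖lam‖ * ‖e‖ * ‖p.coeff 1‖ := by gcongr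
          _ = (‖lam‖ * ‖p.coeff 1‖) * ‖e‖ := by ring
          _ = 1 := by rw [hen, mul_inv_cancel₀ (by positivity)])
      have heq : ∀ u, a + g * (w + g⁻¹ * e * u) = a + g * w + e * u := by
        intro u
        rw [mul_add, ← mul_assoc g, ← mul_assoc g, mul_inv_cancel₀ hg, one_mul, add_assoc]
      simp_rw [heq, h0, norm_zero, le_refl])
  rw [zero_mul] at key
  exact norm_le_zero_iff.1 key

lemma le_rpow_neg_inv {a Y : ℝ} {k : ℕ} (hk : 1 ≤ k) (ha : 0 ≤ a) (h : a ^ k * Y ≤ 1)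
    (hY : 0 < Y) : a ≤ Y ^ (-(1 / (k : ℝ))) := by
  have hk0 : k ≠ 0 := by omega
  rw [← Real.pow_rpow_inv_natCast ha hk0, Real.rpow_neg hY.le, ← Real.inv_rpow hY.le, one_div]
  refine Real.rpow_le_rpow (by positivity) ?_ (by positivity)
  rwa [← one_div, le_div_iff₀ hY]

/-- The van der Corput estimate in one variable. -/
theorem norm_integral_line_le (hK : IsNormalized K) {ϖ : K} (hϖ : ‖ϖ‖ = (residueCard K : ℝ)⁻¹)
    {k s : ℕ} (hk : 1 ≤ k) {M : ℝ} (hM : 1 ≤ M)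
    (hMs : M * ‖ϖ‖ ^ s < ‖((k.factorial : ℕ) : K)‖)
    {ψ : AddChar K Circle} (hψ : ∀ a : K, ‖a‖ < 1 → ψ a = 1)
    (hψ1 : ∃ a : K, ‖a‖ ≤ 1 ∧ ψ a ≠ 1) (h : Polynomial K) {j : ℕ} (hj : 1 ≤ j) (hjk : j ≤ k)
    (hupper : ∀ a, ‖a‖ ≤ ‖ϖ‖ ^ s → ∀ i, 1 ≤ i → ‖(Polynomial.taylor a h).coeff i‖ ≤ M)
    (hlower : ∀ a, ‖a‖ ≤ ‖ϖ‖ ^ s → 1 ≤ ‖(Polynomial.taylor a h).coeff j‖)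
    {lam : K} (hlam : lam ≠ 0) :
    ‖∫ t, ((ψ (lam * h.eval (ϖ ^ s * t)) : Circle) : ℂ) ∂(unitHaar K)‖ ≤
      (k * (‖ϖ‖ ^ s)⁻¹ * ‖ϖ‖⁻¹ * (‖((k.factorial : ℕ) : K)‖ * ‖ϖ‖ ^ s) ^ (-(1 / (k : ℝ)))) *
        ‖lam‖ ^ (-(1 / (k : ℝ))) := by
  have : ProperSpace K := ProperSpace.of_locallyCompactSpace K
  have : CompleteSpace K := inferInstance
  set κ := ‖((k.factorial : ℕ) : K)‖
  set Q := ‖ϖ‖ with hQ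
  set R := Q ^ s with hR
  have hq := (exists_uniformizer hK).1
  have hQ0 : 0 < Q := by rw [hϖ]; positivity
  have hQ1 : Q < 1 := by
    rw [hϖ]; exact inv_lt_one_of_one_lt₀ (by exact_mod_cast hq)
  have hϖ0 : ϖ ≠ 0 := norm_pos_iff.1 hQ0
  have hR0 : 0 < R := by positivity
  have hR1 : R ≤ 1 := pow_le_one₀ hQ0.le hQ1.le
  have hκ0 : 0 < κ := lt_of_le_of_lt (by positivity) hMs
  -- Strictness makes translations of `t` by multiples of `ϖ ^ r` move `ϖ ^ s * t` by less than `ρ`,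
  -- so they preserve the excluded set.
  have hRlt : R < 1 := (le_mul_of_one_le_left hR0.le hM).trans_lt
    (hMs.trans_le (IsUltrametricDist.norm_natCast_le_one K _))
  have hX : 0 < ‖lam‖ := norm_pos_iff.2 hlam
  have hk1 : (1 : ℝ) ≤ k := by exact_mod_cast hk
  set Y := κ * R * ‖lam‖ with hY
  have hY0 : 0 < Y := by positivity
  have hsplit : (κ * R) ^ (-(1 / (k : ℝ))) * ‖lam‖ ^ (-(1 / (k : ℝ))) = Y ^ (-(1 / (k : ℝ))) := by
    rw [hY, Real.mul_rpow (by positivity) hX.le]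
  rw [mul_assoc _ ((κ * R) ^ _), hsplit]
  have hYpos : 0 < Y ^ (-(1 / (k : ℝ))) := Real.rpow_pos_of_pos hY0 _
  set F : K → ℂ := fun t => ((ψ (lam * h.eval (ϖ ^ s * t)) : Circle) : ℂ) with hFdef
  have hF1 (t : K) : ‖F t‖ ≤ 1 := (Circle.norm_coe _).le
  have hF : Continuous F := by
    have := continuous_addChar hψ
    have := h.continuous
    fun_prop
  -- If `lam` is so small that no `ρ ≤ R` is admissible, the trivial bound `1` is good enough.
  rcases lt_or_ge (R ^ k * Y) 1 with hsmall | hbig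
  · have h1 := le_rpow_neg_inv hk hR0.le hsmall.le hY0
    have h2 : ‖∫ t, F t ∂(unitHaar K)‖ ≤ 1 := by
      simpa using norm_integral_le_of_norm_le_const (μ := unitHaar K) (.of_forall hF1)
    refine h2.trans ?_
    calc (1 : ℝ) = 1 * R⁻¹ * 1 * R := by field_simp
      _ ≤ k * R⁻¹ * Q⁻¹ * Y ^ (-(1 / (k : ℝ))) := by
          gcongr
          exact (one_le_inv₀ hQ0).2 hQ1.le
  -- the scale at which the derivative is just large enough
  obtain ⟨r, hsr, hr, hr'⟩ : ∃ r, s ≤ r ∧ 1 ≤ (Q ^ r) ^ k * Y ∧ (Q ^ (r + 1)) ^ k * Y < 1 := by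
    have hex : ∃ m, (Q ^ (s + m)) ^ k * Y < 1 := by
      obtain ⟨m, hm⟩ := exists_pow_lt_of_lt_one (show 0 < Y⁻¹ by positivity) hQ1
      refine ⟨m, ?_⟩
      have h1 : (Q ^ (s + m)) ^ k ≤ Q ^ m := by
        rw [← pow_mul]
        exact pow_le_pow_of_le_one hQ0.le hQ1.le (by nlinarith)
      calc _ ≤ Q ^ m * Y := by gcongr
        _ < Y⁻¹ * Y := by gcongr
        _ = 1 := inv_mul_cancel₀ hY0.ne'
    classical
    have hfind := Nat.find_spec hex
    rcases hm : Nat.find hex with _ | m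
    · rw [hm] at hfind
      exact absurd hfind (not_lt.2 hbig)
    · rw [hm] at hfind
      exact ⟨s + m, by omega, not_lt.1 (Nat.find_min hex (by omega)), hfind⟩
  -- The factor `Q⁻¹` is the price of rounding `ρ` to a power of the norm of the uniformizer.
  have hbound : Q ^ r ≤ Q⁻¹ * Y ^ (-(1 / (k : ℝ))) := by
    have h1 := le_rpow_neg_inv hk (by positivity) hr'.le hY0
    rw [inv_mul_eq_div, le_div_iff₀ hQ0, ← pow_succ]
    exact h1
  set ρ := Q ^ r with hρ
  have hρ0 : 0 < ρ := by positivity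
  have hρR : ρ ≤ R := pow_le_pow_of_le_one hQ0.le hQ1.le hsr
  obtain ⟨S, hS, hgood⟩ := exists_finset_linear_term_dominates h hM hρ0 hρR hR1 hMs hj hjk
    hupper hlower
  set A := Metric.closedBall (0 : K) 1
  have hA : MeasurableSet A := Metric.isClosed_closedBall.measurableSet
  -- The stationary set, in the coordinate `t`. Rescaling by `ϖ ^ s` gives each disc measure at most
  -- `R⁻¹ * ρ`.
  set U : Set K := ⋃ c ∈ S, {t | ‖ϖ ^ s * t - c‖ < ρ} with hU
  have hUm : MeasurableSet U := by
    refine S.measurableSet_biUnion fun c _ => IsOpen.measurableSet ?_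
    exact isOpen_lt (by fun_prop) continuous_const
  have hnorm (t : K) (ht : t ∈ A) : ‖ϖ ^ s * t‖ ≤ R := by
    rw [mem_closedBall_zero_iff] at ht
    rw [norm_mul, norm_pow]
    exact mul_le_of_le_one_right hR0.le ht
  have hUmeas : (haar K) U ≤ ENNReal.ofReal (k * (R⁻¹ * ρ)) := by
    have hone (c : K) : (haar K) {t | ‖ϖ ^ s * t - c‖ < ρ} ≤ ENNReal.ofReal (R⁻¹ * ρ) := by
      have hpow : R⁻¹ * ρ = ‖ϖ‖ ^ (r - s) := by
        rw [inv_mul_eq_div, div_eq_iff hR0.ne', hρ, hR, ← hQ, ← pow_add, Nat.sub_add_cancel hsr]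
      rw [hpow]
      refine le_trans (measure_mono ?_) (haar_closedBall_le hK hϖ ((ϖ ^ s)⁻¹ * c) (r - s))
      intro t ht
      rw [mem_closedBall_iff_norm, ← hpow]
      have h1 : t - (ϖ ^ s)⁻¹ * c = (ϖ ^ s)⁻¹ * (ϖ ^ s * t - c) := by field_simp
      rw [h1, norm_mul, norm_inv, norm_pow]
      exact mul_le_mul_of_nonneg_left (le_of_lt ht) (by positivity)
    refine (measure_biUnion_finset_le _ _).trans ((Finset.sum_le_sum fun c _ => hone c).trans ?_)
    rw [Finset.sum_const, nsmul_eq_mul, ENNReal.ofReal_mul (p := (k : ℝ)) (by positivity), ENNReal.ofReal_natCast]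
    gcongr
  have hgoodint : ∫ t in A \ U, F t ∂(haar K) = 0 := by
    have hginv (w x : K) (hw : ‖w‖ ≤ 1) (hx : x ∈ A \ U) : x + ϖ ^ r * w ∈ A \ U := by
      have hw1 : ‖ϖ ^ r * w‖ ≤ 1 := by
        rw [norm_mul, norm_pow]
        exact mul_le_one₀ (pow_le_one₀ hQ0.le hQ1.le) (norm_nonneg _) hw
      refine ⟨(add_mem_closedBall_iff hw1 x).2 hx.1, fun hmem => hx.2 ?_⟩
      simp only [hU, Set.mem_iUnion, Set.mem_ofPred_eq, exists_prop] at hmem ⊢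
      obtain ⟨c, hc, hlt⟩ := hmem
      refine ⟨c, hc, ?_⟩
      have h1 : ϖ ^ s * x - c = (ϖ ^ s * (x + ϖ ^ r * w) - c) - ϖ ^ s * (ϖ ^ r * w) := by ring
      rw [h1]
      refine (norm_sub_le_max_norm _ _).trans_lt (max_lt hlt ?_)
      rw [norm_mul, norm_mul, norm_pow, norm_pow]
      calc R * (ρ * ‖w‖) ≤ R * (ρ * 1) := by gcongr
        _ < 1 * (ρ * 1) := by gcongr
        _ = ρ := by ring
    have hdom (x : K) (hx : x ∈ A \ U) :=
      hgood (ϖ ^ s * x) (hnorm x hx.1) fun c hc => by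
        by_contra! hlt
        exact hx.2 (Set.mem_biUnion (t := fun c => {t | ‖ϖ ^ s * t - c‖ < ρ}) hc hlt)
    have key := norm_setIntegral_le_of_average (haar K) (unitHaar K) hF hF1
      (c := fun w => ϖ ^ r * w) (by fun_prop) (S := A \ U) (hA.diff hUm)
      (ne_top_of_le_ne_top (by simp [A, haar_closedBall_one]) (measure_mono Set.sdiff_subset))
      (by
        filter_upwards [ae_unitHaar] with w hw x
        refine ⟨fun hx => ?_, hginv w x hw⟩
        simpa using hginv (-w) _ (by simpa using hw) hx) (B := 0) (by
        intro t ht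
        have hg : ‖ϖ ^ s * ϖ ^ r‖ = R * ρ := by rw [norm_mul, norm_pow, norm_pow]
        -- The disc of radius `R * ρ` around `ϖ ^ s * t` is the image of `t + ϖ ^ r * w`, `‖w‖ ≤ 1`,
        -- which lies in the good set. Hence the linear term dominates at each of its points, as
        -- required.
        have hg0 : ϖ ^ s * ϖ ^ r ≠ 0 := by positivity
        have hzero := integral_eq_zero_of_linear_term_dominates hψ hψ1 h (ϖ ^ s * t)
          (ϖ ^ s * ϖ ^ r) lam hg0 (by
            intro b hb i hi
            have hb' : ‖(ϖ ^ s * ϖ ^ r)⁻¹ * b‖ ≤ 1 := by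
              rw [norm_mul, norm_inv, inv_mul_le_iff₀ (norm_pos_iff.2 hg0), mul_one]
              exact hb
            have h1 : ϖ ^ s * t + b = ϖ ^ s * (t + ϖ ^ r * ((ϖ ^ s * ϖ ^ r)⁻¹ * b)) := by
              field_simp
            rw [hg, h1]
            exact (hdom _ (hginv _ t hb' ht)).2 i hi) (by
            rw [hg]
            calc (1 : ℝ) ≤ ρ ^ k * Y := hr
              _ = ‖lam‖ * (κ * ρ ^ (k - 1)) * (R * ρ) := by
                  rw [hY, ← Nat.sub_add_cancel hk, pow_succ, Nat.add_sub_cancel]; ring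
              _ ≤ _ := by
                  gcongr
                  exact (hdom t ht).1)
        have h1 (w : K) : F (t + ϖ ^ r * w) =
            ((ψ (lam * h.eval (ϖ ^ s * t + ϖ ^ s * ϖ ^ r * w)) : Circle) : ℂ) := by
          simp only [F, mul_add, mul_assoc]
        simp_rw [h1, hzero, norm_zero, le_refl])
    rw [zero_mul] at key
    exact norm_le_zero_iff.1 key
  have hint : IntegrableOn F A (haar K) := by
    have : IsFiniteMeasure ((haar K).restrict A) := ⟨by simp [A, haar_closedBall_one]⟩
    exact (integrable_const (1 : ℝ)).mono' hF.aestronglyMeasurable (.of_forall hF1)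
  have hsum : ∫ t, F t ∂(unitHaar K) = ∫ t in A ∩ U, F t ∂(haar K) := by
    rw [unitHaar, ← integral_inter_add_sdiff hUm hint, hgoodint, add_zero]
  rw [hsum]
  have hAU : (haar K) (A ∩ U) ≤ ENNReal.ofReal (k * (R⁻¹ * ρ)) :=
    (measure_mono Set.inter_subset_right).trans hUmeas
  have h1 := norm_setIntegral_le_of_norm_le_const (μ := haar K) (s := A ∩ U) (f := F) (C := 1)
    (hAU.trans_lt ENNReal.ofReal_lt_top) (fun t _ => hF1 t)
  rw [one_mul] at h1
  refine h1.trans ((ENNReal.toReal_le_of_le_ofReal (by positivity) hAU).trans ?_)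
  calc _ ≤ k * (R⁻¹ * (Q⁻¹ * Y ^ (-(1 / (k : ℝ))))) := by gcongr
    _ = _ := by ring

/-! ### Coefficients of restrictions to lines. -/

section CoeffBounds

variable {K : Type*} [NormedField K]

/-- All coefficients of `p` have norm at most `c`. -/
def CoeffLE (p : Polynomial K) (c : ℝ) : Prop := ∀ i, ‖p.coeff i‖ ≤ c

lemma coeffLE_one : CoeffLE (1 : Polynomial K) 1 := fun i => by
  rw [Polynomial.coeff_one]; split_ifs <;> simp

lemma lineRestrict_eq_sum {d : ℕ} (x u : Fin d → K) (P : MvPolynomial (Fin d) K) :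
    lineRestrict x u P = ∑ m ∈ P.support, Polynomial.C (P.coeff m) *
      ∏ i, (Polynomial.C (x i) + Polynomial.C (u i) * Polynomial.X) ^ m i := by
  rw [lineRestrict, MvPolynomial.aeval_def, MvPolynomial.eval₂_eq']
  rfl

variable [IsUltrametricDist K]

lemma CoeffLE.mul {p q : Polynomial K} {a b : ℝ} (hp : CoeffLE p a) (hq : CoeffLE q b) :
    CoeffLE (p * q) (a * b) := by
  intro i
  have ha : 0 ≤ a := (norm_nonneg _).trans (hp 0)
  have hb : 0 ≤ b := (norm_nonneg _).trans (hq 0)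
  rw [Polynomial.coeff_mul]
  refine IsUltrametricDist.norm_sum_le_of_forall_le_of_nonneg (by positivity) fun m _ => ?_
  rw [norm_mul]
  exact mul_le_mul (hp _) (hq _) (norm_nonneg _) ha

lemma CoeffLE.add {p q : Polynomial K} {a : ℝ} (hp : CoeffLE p a) (hq : CoeffLE q a) :
    CoeffLE (p + q) a := fun i => by
  rw [Polynomial.coeff_add]
  exact (IsUltrametricDist.norm_add_le_max _ _).trans (max_le (hp i) (hq i))

lemma CoeffLE.pow {p : Polynomial K} (hp : CoeffLE p 1) (n : ℕ) : CoeffLE (p ^ n) 1 := by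
  induction n with
  | zero => simpa using coeffLE_one
  | succ n ih => simpa [pow_succ] using ih.mul hp

lemma CoeffLE.prod {ι : Type*} (s : Finset ι) {p : ι → Polynomial K} (hp : ∀ i, CoeffLE (p i) 1) :
    CoeffLE (∏ i ∈ s, p i) 1 := by
  classical
  induction s using Finset.induction_on with
  | empty => simpa using coeffLE_one
  | insert a s ha ih => rw [Finset.prod_insert ha]; simpa using (hp a).mul ih

/-- Telescoping in an ultrametric setting loses nothing, so the error `δ` passes through products
and powers of any length. -/
lemma CoeffLE.mul_sub_mul {p q p' q' : Polynomial K} {δ : ℝ} (hq : CoeffLE q 1)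
    (hp' : CoeffLE p' 1) (h : CoeffLE (p - p') δ) (h' : CoeffLE (q - q') δ) :
    CoeffLE (p * q - p' * q') δ := by
  have : p * q - p' * q' = (p - p') * q + p' * (q - q') := by ring
  rw [this]
  exact CoeffLE.add (by simpa using h.mul hq) (by simpa using hp'.mul h')

lemma CoeffLE.pow_sub_pow {p p' : Polynomial K} {δ : ℝ} (hδ : 0 ≤ δ) (hp : CoeffLE p 1)
    (hp' : CoeffLE p' 1) (h : CoeffLE (p - p') δ) (n : ℕ) : CoeffLE (p ^ n - p' ^ n) δ := by
  induction n with
  | zero => intro i; simpa using hδ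
  | succ n ih => rw [pow_succ, pow_succ]; exact CoeffLE.mul_sub_mul hp (hp'.pow n) ih h

lemma CoeffLE.prod_sub_prod {ι : Type*} (s : Finset ι) {p p' : ι → Polynomial K} {δ : ℝ}
    (hδ : 0 ≤ δ) (hp : ∀ i, CoeffLE (p i) 1) (hp' : ∀ i, CoeffLE (p' i) 1)
    (h : ∀ i, CoeffLE (p i - p' i) δ) : CoeffLE (∏ i ∈ s, p i - ∏ i ∈ s, p' i) δ := by
  classical
  induction s using Finset.induction_on with
  | empty => intro i; simpa using hδ
  | insert a s ha ih =>
    rw [Finset.prod_insert ha, Finset.prod_insert ha]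
    exact CoeffLE.mul_sub_mul (CoeffLE.prod s hp) (hp' a) (h a) ih

variable {d : ℕ}

lemma coeffLE_line {x u : Fin d → K} (hx : ∀ i, ‖x i‖ ≤ 1) (hu : ∀ i, ‖u i‖ ≤ 1) (i : Fin d) :
    CoeffLE (Polynomial.C (x i) + Polynomial.C (u i) * Polynomial.X) 1 := by
  refine CoeffLE.add (fun m => ?_) fun m => ?_
  · rw [Polynomial.coeff_C]; split_ifs <;> simp [hx i]
  · rw [Polynomial.coeff_C_mul_X]; split_ifs <;> simp [hu i]

lemma norm_coeff_lineRestrict_le {P : MvPolynomial (Fin d) K} {M : ℝ} (hM : 0 ≤ M)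
    (hP : ∀ m, m ≠ 0 → ‖P.coeff m‖ ≤ M) {x u : Fin d → K} (hx : ∀ i, ‖x i‖ ≤ 1)
    (hu : ∀ i, ‖u i‖ ≤ 1) {i : ℕ} (hi : 1 ≤ i) : ‖(lineRestrict x u P).coeff i‖ ≤ M := by
  rw [lineRestrict_eq_sum, Polynomial.finsetSum_coeff]
  refine IsUltrametricDist.norm_sum_le_of_forall_le_of_nonneg hM fun m _ => ?_
  rw [Polynomial.coeff_C_mul, norm_mul]
  by_cases hm : m = 0
  · have h0 : i ≠ 0 := by omega
    simpa [hm, Polynomial.coeff_one, h0] using hM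
  · simpa using mul_le_mul (hP m hm)
      (CoeffLE.prod Finset.univ (fun l => (coeffLE_line hx hu l).pow (m l)) i) (norm_nonneg _) hM

/-- This spreads a lower bound at one point to a whole ball. The constant term of `P` needs no
bound, since it cancels in the difference. -/
lemma norm_coeff_lineRestrict_sub_le {P : MvPolynomial (Fin d) K} {M δ : ℝ} (hM : 0 ≤ M)
    (hP : ∀ m, m ≠ 0 → ‖P.coeff m‖ ≤ M) {x x' u : Fin d → K} (hx : ∀ i, ‖x i‖ ≤ 1)
    (hx' : ∀ i, ‖x' i‖ ≤ 1) (hu : ∀ i, ‖u i‖ ≤ 1) (hδ : 0 ≤ δ) (h : ∀ i, ‖x i - x' i‖ ≤ δ)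
    (i : ℕ) : ‖(lineRestrict x u P).coeff i - (lineRestrict x' u P).coeff i‖ ≤ M * δ := by
  rw [lineRestrict_eq_sum, lineRestrict_eq_sum, Polynomial.finsetSum_coeff,
    Polynomial.finsetSum_coeff, ← Finset.sum_sub_distrib]
  refine IsUltrametricDist.norm_sum_le_of_forall_le_of_nonneg (by positivity) fun m _ => ?_
  rw [Polynomial.coeff_C_mul, Polynomial.coeff_C_mul, ← mul_sub, ← Polynomial.coeff_sub, norm_mul]
  by_cases hm : m = 0
  · simp [hm]; positivity
  · refine mul_le_mul (hP m hm) ?_ (norm_nonneg _) hM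
    refine CoeffLE.prod_sub_prod Finset.univ hδ (fun l => (coeffLE_line hx hu l).pow (m l))
      (fun l => (coeffLE_line hx' hu l).pow (m l)) (fun l => ?_) i
    refine CoeffLE.pow_sub_pow hδ (coeffLE_line hx hu l) (coeffLE_line hx' hu l) ?_ _
    rw [add_sub_add_right_eq_sub, ← Polynomial.C_sub]
    intro m
    rw [Polynomial.coeff_C]
    split_ifs
    · exact h l
    · simpa using hδ

/-- A large partial derivative of order `j` forces a large `j`-th coefficient along some line. -/
lemma exists_direction (α : Fin d → ℕ) (P : MvPolynomial (Fin d) K) (x : Fin d → K)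
    (hfac : (((∑ j, α j).factorial : ℕ) : K) ≠ 0)
    (h : 1 ≤ ‖MvPolynomial.eval x (polyPartialDeriv α P)‖) :
    ∃ u : Fin d → K, (∀ i, ‖u i‖ ≤ 1) ∧ 1 ≤ ‖(lineRestrict x u P).coeff (∑ j, α j)‖ := by
  classical
  have key := factorial_mul_eval_polyPartialDeriv α P x
  have key2 : ∑ S ∈ (Finset.univ : Finset (Σ j, Fin (α j))).powerset, (-1) ^ S.card *
      (lineRestrict x (fun i => ∑ s ∈ S, (Pi.single s.1 1 : Fin d → K) i) P).coeff (∑ j, α j) =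
      (-1) ^ (∑ j, α j) * MvPolynomial.eval x (polyPartialDeriv α P) := by
    refine mul_left_cancel₀ hfac ?_
    rw [Finset.mul_sum]
    refine (Finset.sum_congr rfl fun S _ => ?_).trans (key.trans ?_) <;> ring
  by_contra! hcon
  have hlt := norm_sum_lt_of_forall_lt (Finset.univ : Finset (Σ j, Fin (α j))).powerset
    (f := fun S => (-1) ^ S.card *
      (lineRestrict x (fun i => ∑ s ∈ S, (Pi.single s.1 1 : Fin d → K) i) P).coeff (∑ j, α j))
    one_pos (fun S _ => by
      rw [norm_mul, norm_pow, norm_neg, norm_one, one_pow, one_mul]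
      refine hcon _ fun i => ?_
      refine IsUltrametricDist.norm_sum_le_of_forall_le_of_nonneg zero_le_one fun s _ => ?_
      rw [Pi.single_apply]
      split_ifs <;> simp)
  rw [key2, norm_mul, norm_pow, norm_neg, norm_one, one_pow, one_mul] at hlt
  exact absurd h (not_le.2 hlt)

end CoeffBounds

/-! ### The estimate for polynomials in several variables. -/

section Polydisc

variable {K : Type*} [NontriviallyNormedField K]

lemma polydisc_eq_pi (d : ℕ) :
    polydisc K d = Set.univ.pi fun _ => Metric.closedBall (0 : K) 1 := by
  ext x; simp [polydisc]

lemma add_mem_polydisc_iff [IsUltrametricDist K] {d : ℕ} {w : Fin d → K} (hw : w ∈ polydisc K d)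
    (x : Fin d → K) : x + w ∈ polydisc K d ↔ x ∈ polydisc K d := by
  refine forall_congr' fun i => ?_
  simpa using add_mem_closedBall_iff (hw i) (x i)

variable [MeasurableSpace K] [BorelSpace K]

lemma measurableSet_polydisc (d : ℕ) : MeasurableSet (polydisc K d) := by
  rw [polydisc_eq_pi]
  exact MeasurableSet.univ_pi fun _ => Metric.isClosed_closedBall.measurableSet

variable [LocallyCompactSpace K]

instance (d : ℕ) : (haarPi K d).IsAddLeftInvariant := by
  have : ProperSpace K := ProperSpace.of_locallyCompactSpace K
  unfold haarPi; infer_instance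

instance (d : ℕ) : SigmaFinite (haarPi K d) := by
  have : ProperSpace K := ProperSpace.of_locallyCompactSpace K
  unfold haarPi; infer_instance

lemma haarPi_polydisc (d : ℕ) : haarPi K d (polydisc K d) = 1 := by
  have : ProperSpace K := ProperSpace.of_locallyCompactSpace K
  rw [polydisc_eq_pi, haarPi, Measure.pi_pi]
  simp [haar_closedBall_one]

instance (d : ℕ) : IsProbabilityMeasure ((haarPi K d).restrict (polydisc K d)) :=
  ⟨by simp [haarPi_polydisc]⟩

variable [IsUltrametricDist K]

/-- The van der Corput estimate for polynomials. -/
theorem norm_integral_polynomial_le (hK : IsNormalized K) {ϖ : K}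
    (hϖ : ‖ϖ‖ = (residueCard K : ℝ)⁻¹) {k s : ℕ} (hk : 1 ≤ k) {M : ℝ} (hM : 1 ≤ M)
    (hMs : M * ‖ϖ‖ ^ s < ‖((k.factorial : ℕ) : K)‖)
    {ψ : AddChar K Circle} (hψ : ∀ a : K, ‖a‖ < 1 → ψ a = 1)
    (hψ1 : ∃ a : K, ‖a‖ ≤ 1 ∧ ψ a ≠ 1) {d : ℕ} (P : MvPolynomial (Fin d) K)
    (hP : ∀ m, m ≠ 0 → ‖P.coeff m‖ ≤ M)
    (hder : ∀ x ∈ polydisc K d, ∃ α : Fin d → ℕ, 0 < ∑ j, α j ∧ ∑ j, α j ≤ k ∧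
      1 ≤ ‖MvPolynomial.eval x (polyPartialDeriv α P)‖) {lam : K} (hlam : lam ≠ 0) :
    ‖∫ x in polydisc K d, ((ψ (lam * MvPolynomial.eval x P) : Circle) : ℂ) ∂(haarPi K d)‖ ≤
      (k * (‖ϖ‖ ^ s)⁻¹ * ‖ϖ‖⁻¹ * (‖((k.factorial : ℕ) : K)‖ * ‖ϖ‖ ^ s) ^ (-(1 / (k : ℝ)))) *
        ‖lam‖ ^ (-(1 / (k : ℝ))) := by
  have : ProperSpace K := ProperSpace.of_locallyCompactSpace K
  set B := (k * (‖ϖ‖ ^ s)⁻¹ * ‖ϖ‖⁻¹ *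
    (‖((k.factorial : ℕ) : K)‖ * ‖ϖ‖ ^ s) ^ (-(1 / (k : ℝ)))) * ‖lam‖ ^ (-(1 / (k : ℝ))) with hB
  have hM0 : 0 ≤ M := zero_le_one.trans hM
  have hκ1 : ‖((k.factorial : ℕ) : K)‖ ≤ 1 := IsUltrametricDist.norm_natCast_le_one K _
  have hR1 : ‖ϖ‖ ^ s ≤ 1 := ((le_mul_of_one_le_left (by positivity) hM).trans hMs.le).trans hκ1
  have hκ0 : 0 < ‖((k.factorial : ℕ) : K)‖ := lt_of_le_of_lt (by positivity) hMs
  have hcψ := continuous_addChar hψ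
  have hcP := MvPolynomial.continuous_eval P
  have hsmall {a : K} (ha : ‖a‖ ≤ 1) : ‖ϖ ^ s * a‖ ≤ ‖ϖ‖ ^ s := by
    rw [norm_mul, norm_pow]; exact mul_le_of_le_one_right (by positivity) ha
  have hreal : (haarPi K d).real (polydisc K d) = 1 := by simp [Measure.real, haarPi_polydisc]
  have hfin : haarPi K d (polydisc K d) ≠ ⊤ := by simp [haarPi_polydisc]
  have hmem : ∀ᵐ z ∂(haarPi K d).restrict (polydisc K d), z ∈ polydisc K d :=
    ae_restrict_mem (measurableSet_polydisc d)
  -- The integral is averaged over the balls `x + ϖ ^ s • polydisc K d`. The bound is needed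
  -- separately for each `x`, so `α` and the direction `u` may depend on `x` in any way, and no
  -- balls are counted.
  have h1 := norm_setIntegral_le_of_average (haarPi K d) ((haarPi K d).restrict (polydisc K d))
    (F := fun x => ((ψ (lam * MvPolynomial.eval x P) : Circle) : ℂ)) (by fun_prop)
    (fun x => (Circle.norm_coe _).le) (c := fun z => ϖ ^ s • z) (by fun_prop)
    (measurableSet_polydisc d) hfin (by
      filter_upwards [hmem] with z hz x
      exact add_mem_polydisc_iff (fun i => (hsmall (hz i)).trans hR1) x) (B := B) (by
    intro x hx
    obtain ⟨α, hα0, hαk, hα⟩ := hder x hx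
    obtain ⟨u, hu, hlarge⟩ := exists_direction α P x (by
      rw [← norm_pos_iff]
      obtain ⟨c, hc⟩ := Nat.factorial_dvd_factorial hαk
      rw [hc, Nat.cast_mul, norm_mul] at hκ0
      exact pos_of_mul_pos_left hκ0 (norm_nonneg _)) hα
    -- Within the ball around `x`, a second average runs along lines in the direction `u`.
    have h2 := norm_setIntegral_le_of_average (haarPi K d) (unitHaar K)
      (F := fun z => ((ψ (lam * MvPolynomial.eval (x + ϖ ^ s • z) P) : Circle) : ℂ)) (by fun_prop)
      (fun x => (Circle.norm_coe _).le) (c := fun t => t • u) (by fun_prop)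
      (measurableSet_polydisc d) hfin (by
        filter_upwards [ae_unitHaar] with t ht z
        refine add_mem_polydisc_iff (fun i => ?_) z
        rw [Pi.smul_apply, smul_eq_mul, norm_mul]
        exact mul_le_one₀ ht (norm_nonneg _) (hu i)) (B := B) (by
      intro z hz
      have hpt (a : K) (ha : ‖a‖ ≤ ‖ϖ‖ ^ s) (i : Fin d) :
          ‖(x i + ϖ ^ s * z i + a * u i) - x i‖ ≤ ‖ϖ‖ ^ s := by
        rw [add_assoc, add_sub_cancel_left]
        refine (IsUltrametricDist.norm_add_le_max _ _).trans (max_le (hsmall (hz i)) ?_)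
        rw [norm_mul]
        exact (mul_le_of_le_one_right (norm_nonneg _) (hu i)).trans ha
      have hpt1 (a : K) (ha : ‖a‖ ≤ ‖ϖ‖ ^ s) (i : Fin d) :
          ‖x i + ϖ ^ s * z i + a * u i‖ ≤ 1 := by
        have := IsUltrametricDist.norm_add_le_max ((x i + ϖ ^ s * z i + a * u i) - x i) (x i)
        rw [sub_add_cancel] at this
        exact this.trans (max_le ((hpt a ha i).trans hR1) (hx i))
      have h3 := norm_integral_line_le hK hϖ hk hM hMs hψ hψ1
        (lineRestrict (fun i => x i + ϖ ^ s * z i) u P) hα0 hαk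
        (fun a ha i hi => by
          rw [taylor_lineRestrict]
          exact norm_coeff_lineRestrict_le hM0 hP (hpt1 a ha) hu hi)
        (fun a ha => by
          rw [taylor_lineRestrict]
          -- The `j`-th coefficient varies by at most `M * ‖ϖ‖ ^ s < 1` on the ball, so it keeps its
          -- norm.
          have h4 := norm_coeff_lineRestrict_sub_le hM0 hP (hpt1 a ha) hx hu (by positivity)
            (hpt a ha) (∑ j, α j)
          rw [norm_eq_of_norm_sub_lt (h4.trans_lt ((hMs.trans_le hκ1).trans_le hlarge))]
          exact hlarge) hlam
      rw [← hB] at h3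
      convert h3 using 6 with t
      rw [eval_lineRestrict]
      refine congrArg (fun y => ((ψ (lam * MvPolynomial.eval y P) : Circle) : ℂ))
        (funext fun i => ?_)
      simp
      ring)
    rwa [hreal, mul_one] at h2)
  rwa [hreal, mul_one] at h1

end Polydisc

/-! ### Approximation of convergent power series by polynomials. -/

section Truncation

variable {K : Type*} [NontriviallyNormedField K] {d : ℕ}

lemma isConvergent_iff (f : MvPowerSeries (Fin d) K) :
    IsConvergent f ↔ Tendsto (fun i => ‖MvPowerSeries.coeff i f‖) cofinite (𝓝 0) := by
  simp [IsConvergent, MvPowerSeries.IsRestricted, Finsupp.prod]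

lemma IsConvergent.finite {f : MvPowerSeries (Fin d) K} (hf : IsConvergent f) {δ : ℝ}
    (hδ : 0 < δ) : {i | δ ≤ ‖MvPowerSeries.coeff i f‖}.Finite := by
  have h := ((isConvergent_iff f).1 hf).eventually (gt_mem_nhds hδ)
  simpa [Filter.eventually_cofinite] using h

lemma IsConvergent.norm_coeff_le {n : ℕ} {f : Fin n → MvPowerSeries (Fin d) K}
    (hf : ∀ l, IsConvergent (f l)) (l : Fin n) {i : Fin d →₀ ℕ} (hi : i ≠ 0) :
    ‖MvPowerSeries.coeff i (f l)‖ ≤ gaussNormSubConst f := by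
  set g := f l - MvPowerSeries.C (MvPowerSeries.constantCoeff (f l)) with hg
  have hcoeff (m : Fin d →₀ ℕ) (hm : m ≠ 0) :
      MvPowerSeries.coeff m g = MvPowerSeries.coeff m (f l) := by
    classical
    simp [hg, MvPowerSeries.coeff_C, hm]
  -- A real supremum bounds its terms only when the family is bounded. Here only finitely many
  -- coefficients have norm at least `1`.
  have hbdd : MvPowerSeries.HasGaussNorm (fun a : K => ‖a‖) (fun _ => (1 : ℝ)) g := by
    simp only [MvPowerSeries.HasGaussNorm, Finsupp.prod, one_pow, Finset.prod_const_one, mul_one]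
    obtain ⟨C, hC⟩ := (((hf l).finite one_pos).image
      fun i => ‖MvPowerSeries.coeff i g‖).bddAbove
    refine ⟨max (max C 1) ‖MvPowerSeries.coeff 0 g‖, ?_⟩
    rintro _ ⟨m, rfl⟩
    by_cases hm : m = 0
    · subst hm; exact le_max_right _ _
    refine le_max_of_le_left ?_
    by_cases h1 : 1 ≤ ‖MvPowerSeries.coeff m (f l)‖
    · exact le_max_of_le_left (hC ⟨m, h1, rfl⟩)
    · refine le_max_of_le_right ?_
      simp only [hcoeff m hm]
      exact (not_le.1 h1).le
  have h1 := MvPowerSeries.le_gaussNorm _ _ g hbdd i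
  simp only [Finsupp.prod, one_pow, Finset.prod_const_one, mul_one, hcoeff i hi] at h1
  exact h1.trans (le_ciSup (f := fun l => MvPowerSeries.gaussNorm (fun a : K => ‖a‖)
    (fun _ => (1 : ℝ)) (f l - MvPowerSeries.C (MvPowerSeries.constantCoeff (f l))))
    (Set.finite_range _).bddAbove l)

lemma partialDeriv_coe (α : Fin d → ℕ) (P : MvPolynomial (Fin d) K) :
    partialDeriv α (P : MvPowerSeries (Fin d) K) = (polyPartialDeriv α P : MvPolynomial (Fin d) K) := by
  rw [partialDeriv, polyPartialDeriv]
  induction List.finRange d with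
  | nil => simp
  | cons j l ih =>
    simp only [List.map_cons, List.prod_cons, Module.End.mul_apply, ih]
    generalize ((l.map fun j => ((MvPolynomial.pderiv j : Derivation K _ _) :
      Module.End K (MvPolynomial (Fin d) K)) ^ α j).prod P) = Q
    induction α j with
    | zero => simp
    | succ m ih =>
      rw [pow_succ', pow_succ', Module.End.mul_apply, Module.End.mul_apply, ih]
      exact MvPowerSeries.pderiv_coe _

/-- The part of a power series with coefficients of norm at least `δ`. -/
noncomputable def truncation (f : MvPowerSeries (Fin d) K) (hf : IsConvergent f) {δ : ℝ}
    (hδ : 0 < δ) : MvPolynomial (Fin d) K :=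
  ∑ i ∈ (hf.finite hδ).toFinset, MvPolynomial.monomial i (MvPowerSeries.coeff i f)

lemma coeff_truncation (f : MvPowerSeries (Fin d) K) (hf : IsConvergent f) {δ : ℝ} (hδ : 0 < δ)
    (i : Fin d →₀ ℕ) : (truncation f hf hδ).coeff i =
      if δ ≤ ‖MvPowerSeries.coeff i f‖ then MvPowerSeries.coeff i f else 0 := by
  classical
  simp [truncation, MvPolynomial.coeff_sum, MvPolynomial.coeff_monomial]

/-- Convergent power series with all coefficients of norm at most `δ`. -/
def IsSmall (δ : ℝ) (f : MvPowerSeries (Fin d) K) : Prop :=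
  IsConvergent f ∧ ∀ i, ‖MvPowerSeries.coeff i f‖ ≤ δ

lemma isSmall_sub_truncation (f : MvPowerSeries (Fin d) K) (hf : IsConvergent f) {δ : ℝ}
    (hδ : 0 < δ) : IsSmall δ (f - (truncation f hf hδ : MvPowerSeries (Fin d) K)) := by
  have hc (i : Fin d →₀ ℕ) :
      MvPowerSeries.coeff i (f - (truncation f hf hδ : MvPowerSeries (Fin d) K)) =
      if δ ≤ ‖MvPowerSeries.coeff i f‖ then 0 else MvPowerSeries.coeff i f := by
    rw [map_sub, MvPolynomial.coeff_coe, coeff_truncation]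
    split_ifs <;> simp
  refine ⟨(isConvergent_iff _).2 ?_, fun i => ?_⟩
  · refine squeeze_zero (fun _ => norm_nonneg _) (fun i => ?_) ((isConvergent_iff f).1 hf)
    rw [hc]
    split_ifs <;> simp
  · rw [hc]
    split_ifs with h
    · simpa using hδ.le
    · exact (not_le.1 h).le

lemma isConvergent_coe (P : MvPolynomial (Fin d) K) :
    IsConvergent (P : MvPowerSeries (Fin d) K) := by
  rw [isConvergent_iff]
  refine tendsto_nhds_of_eventually_eq ?_
  rw [Filter.eventually_cofinite]
  refine P.support.finite_toSet.subset fun i hi => ?_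
  simpa using hi

lemma eval_coe (P : MvPolynomial (Fin d) K) (x : Fin d → K) :
    eval (P : MvPowerSeries (Fin d) K) x = MvPolynomial.eval x P := by
  rw [eval, MvPolynomial.eval_eq', tsum_eq_sum (s := P.support)]
  · simp
  · intro i hi
    simp [MvPolynomial.notMem_support_iff.1 hi]

lemma norm_monomial_le {x : Fin d → K} (hx : x ∈ polydisc K d) (i : Fin d →₀ ℕ) :
    ‖∏ j, x j ^ i j‖ ≤ 1 := by
  rw [norm_prod]
  refine Finset.prod_le_one (fun _ _ => norm_nonneg _) fun j _ => ?_
  rw [norm_pow]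
  exact pow_le_one₀ (norm_nonneg _) (hx j)

lemma polyPartialDeriv_zero (P : MvPolynomial (Fin d) K) : polyPartialDeriv 0 P = P := by
  simp [polyPartialDeriv]

lemma partialDeriv_zero (f : MvPowerSeries (Fin d) K) : partialDeriv 0 f = f := by
  simp [VanDerCorput.partialDeriv]

lemma factorial_ne_zero_of_ringChar {k : ℕ} (hchar : ringChar K = 0 ∨ k < ringChar K) :
    ((k.factorial : ℕ) : K) ≠ 0 := by
  rw [Ne, ringChar.spec]
  rcases hchar with h | h
  · rw [h, zero_dvd_iff]; exact k.factorial_ne_zero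
  · rcases CharP.char_is_prime_or_zero K (ringChar K) with hp | hp
    · rw [hp.dvd_factorial]; omega
    · omega

variable [IsUltrametricDist K]

/-- The integer factors have norm at most `1`, so one truncation approximates `f` and all its
derivatives with the same error. -/
lemma IsSmall.pderiv {δ : ℝ} {f : MvPowerSeries (Fin d) K} (hf : IsSmall δ f) (j : Fin d) :
    IsSmall δ (MvPowerSeries.pderiv K j f) := by
  have hle (i : Fin d →₀ ℕ) : ‖MvPowerSeries.coeff i (MvPowerSeries.pderiv K j f)‖ ≤
      ‖MvPowerSeries.coeff (i + Finsupp.single j 1) f‖ := by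
    rw [MvPowerSeries.coeff_pderiv, norm_mul]
    refine mul_le_of_le_one_right (norm_nonneg _) ?_
    simpa using IsUltrametricDist.norm_natCast_le_one K (i j + 1)
  refine ⟨(isConvergent_iff _).2 ?_, fun i => (hle i).trans (hf.2 _)⟩
  refine squeeze_zero (fun _ => norm_nonneg _) hle ?_
  exact ((isConvergent_iff f).1 hf.1).comp (add_left_injective _).tendsto_cofinite

lemma IsSmall.partialDeriv {δ : ℝ} {f : MvPowerSeries (Fin d) K} (hf : IsSmall δ f)
    (α : Fin d → ℕ) : IsSmall δ (partialDeriv α f) := by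
  rw [VanDerCorput.partialDeriv]
  induction List.finRange d with
  | nil => simpa using hf
  | cons j l ih =>
    simp only [List.map_cons, List.prod_cons, Module.End.mul_apply]
    induction α j with
    | zero => simpa using ih
    | succ m ih' =>
      rw [pow_succ', Module.End.mul_apply]
      exact ih'.pderiv j

lemma summable_eval [CompleteSpace K] {f : MvPowerSeries (Fin d) K} (hf : IsConvergent f)
    {x : Fin d → K} (hx : x ∈ polydisc K d) :
    Summable fun i => MvPowerSeries.coeff i f * ∏ j, x j ^ i j := by
  refine NonarchimedeanAddGroup.summable_of_tendsto_cofinite_zero ?_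
  rw [tendsto_zero_iff_norm_tendsto_zero]
  refine squeeze_zero (fun _ => norm_nonneg _) (fun i => ?_) ((isConvergent_iff f).1 hf)
  rw [norm_mul]
  exact mul_le_of_le_one_right (norm_nonneg _) (norm_monomial_le hx i)

lemma IsSmall.norm_eval_le {δ : ℝ} {f : MvPowerSeries (Fin d) K} (hf : IsSmall δ f)
    {x : Fin d → K} (hx : x ∈ polydisc K d) : ‖eval f x‖ ≤ δ := by
  refine IsUltrametricDist.norm_tsum_le_of_forall_le_of_nonneg
    ((norm_nonneg _).trans (hf.2 0)) fun i => ?_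
  rw [norm_mul]
  exact (mul_le_of_le_one_right (norm_nonneg _) (norm_monomial_le hx i)).trans (hf.2 i)

lemma IsConvergent.eval_add [CompleteSpace K] {f g : MvPowerSeries (Fin d) K}
    (hf : IsConvergent f) (hg : IsConvergent g) {x : Fin d → K} (hx : x ∈ polydisc K d) :
    eval (f + g) x = eval f x + eval g x := by
  rw [eval, eval, eval, ← (summable_eval hf hx).tsum_add (summable_eval hg hx)]
  simp [add_mul]

/-- Uniform approximation of a convergent power series and its derivatives by a polynomial. -/
lemma norm_eval_partialDeriv_sub_le [CompleteSpace K] (f : MvPowerSeries (Fin d) K)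
    (hf : IsConvergent f) {δ : ℝ} (hδ : 0 < δ) (α : Fin d → ℕ) {x : Fin d → K}
    (hx : x ∈ polydisc K d) : ‖eval (partialDeriv α f) x -
      MvPolynomial.eval x (polyPartialDeriv α (truncation f hf hδ))‖ ≤ δ := by
  have hs := (isSmall_sub_truncation f hf hδ).partialDeriv α
  have h1 : partialDeriv α f =
      ((polyPartialDeriv α (truncation f hf hδ) : MvPolynomial (Fin d) K) :
        MvPowerSeries (Fin d) K) +
      partialDeriv α (f - (truncation f hf hδ : MvPowerSeries (Fin d) K)) := by
    rw [← partialDeriv_coe]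
    simp only [partialDeriv]
    rw [← map_add, add_sub_cancel]
  rw [h1, (isConvergent_coe _).eval_add hs.1 hx, eval_coe, add_sub_cancel_left]
  exact hs.norm_eval_le hx

end Truncation

end VanDerCorput

/-! ### Reduction of the theorem to polynomials. -/

open VanDerCorput

theorem proposition3p6
    {K : Type*} [NontriviallyNormedField K] [IsUltrametricDist K] [LocallyCompactSpace K]
    [MeasurableSpace K] [BorelSpace K] (hK : VanDerCorput.IsNormalized K)
    (n k : ℕ) (hk : 1 ≤ k) (hchar : ringChar K = 0 ∨ k < ringChar K) (M : ℝ) :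
    ∃ c : ℝ, ∀ (ψ : AddChar K Circle),
      (∀ a : K, ‖a‖ < 1 → ψ a = 1) → (∃ a : K, ‖a‖ ≤ 1 ∧ ψ a ≠ 1) →
      ∀ (d : ℕ) (f : Fin n → MvPowerSeries (Fin d) K),
        (∀ l, VanDerCorput.IsConvergent (f l)) →
        VanDerCorput.gaussNormSubConst f = M →
        (∀ v : Fin n → K, ‖v‖ = 1 → ∀ x ∈ VanDerCorput.polydisc K d,
          ∃ α : Fin d → ℕ, 0 < ∑ j, α j ∧ ∑ j, α j ≤ k ∧
            1 ≤ ‖∑ l, v l * VanDerCorput.eval (VanDerCorput.partialDeriv α (f l)) x‖) →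
        ∀ y : Fin n → K, y ≠ 0 →
          ‖∫ x in VanDerCorput.polydisc K d,
              ((ψ (∑ l, y l * VanDerCorput.eval (f l) x) : Circle) : ℂ)
              ∂(VanDerCorput.haarPi K d)‖ ≤ c * ‖y‖ ^ (-(1 / (k : ℝ))) := by
  have : ProperSpace K := ProperSpace.of_locallyCompactSpace K
  have : CompleteSpace K := inferInstance
  obtain ⟨hq, ϖ, hϖ⟩ := exists_uniformizer hK
  have hϖ1 : ‖ϖ‖ < 1 := by
    rw [hϖ]; exact inv_lt_one_of_one_lt₀ (by exact_mod_cast hq)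
  have hκ : 0 < ‖((k.factorial : ℕ) : K)‖ :=
    norm_pos_iff.2 (factorial_ne_zero_of_ringChar hchar)
  -- The one-variable argument needs a coefficient bound of at least `1`, so that `max M 1 * ‖ϖ‖ ^ s
  -- < |k!|` also forces `‖ϖ‖ ^ s < |k!|`.
  have hM1 : 1 ≤ max M 1 := le_max_right _ _
  have hM0 : 0 < max M 1 := one_pos.trans_le hM1
  obtain ⟨s, hs⟩ := exists_pow_lt_of_lt_one (div_pos hκ hM0) hϖ1
  rw [lt_div_iff₀' hM0] at hs
  refine ⟨k * (‖ϖ‖ ^ s)⁻¹ * ‖ϖ‖⁻¹ * (‖((k.factorial : ℕ) : K)‖ * ‖ϖ‖ ^ s) ^ (-(1 / (k : ℝ))), ?_⟩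
  intro ψ hψ hψ1 d f hf hfM hder y hy
  have : Nonempty (Fin n) := by
    by_contra h
    rw [not_nonempty_iff] at h
    exact hy (Subsingleton.elim _ _)
  obtain ⟨l₀, hl₀⟩ := Finite.exists_max fun l => ‖y l‖
  have hynorm : ‖y‖ = ‖y l₀‖ :=
    le_antisymm ((pi_norm_le_iff_of_nonneg (norm_nonneg _)).2 hl₀) (norm_le_pi_norm y l₀)
  have hlam : y l₀ ≠ 0 := by
    rw [← norm_pos_iff, ← hynorm]; exact norm_pos_iff.2 hy
  have hlam0 : 0 < ‖y l₀‖ := norm_pos_iff.2 hlam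
  set v : Fin n → K := fun l => (y l₀)⁻¹ * y l with hv
  have hvle (l : Fin n) : ‖v l‖ ≤ 1 := by
    rw [hv, norm_mul, norm_inv, inv_mul_le_iff₀ hlam0, mul_one]
    exact hl₀ l
  have hv1 : ‖v‖ = 1 := by
    refine le_antisymm ((pi_norm_le_iff_of_nonneg zero_le_one).2 hvle) ?_
    have h1 := norm_le_pi_norm v l₀
    have h2 : v l₀ = 1 := inv_mul_cancel₀ hlam
    rwa [h2, norm_one] at h1
  have hyv (l : Fin n) : y l = y l₀ * v l := by rw [hv, mul_inv_cancel_left₀ hlam]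
  -- An error below `1` preserves the lower bounds on derivatives. An error below `‖y‖⁻¹` changes
  -- the phase only by an element of the maximal ideal. The polynomial depends on `y`, but its
  -- coefficient bound does not.
  obtain ⟨δ, hδ, hδlt⟩ := exists_between (show 0 < min 1 ‖y l₀‖⁻¹ by positivity)
  set P : MvPolynomial (Fin d) K := ∑ l, v l • truncation (f l) (hf l) hδ with hP
  have hPapprox (α : Fin d → ℕ) (x : Fin d → K) (hx : x ∈ polydisc K d) :
      ‖∑ l, v l * eval (partialDeriv α (f l)) x -
        MvPolynomial.eval x (polyPartialDeriv α P)‖ ≤ δ := by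
    simp only [hP, map_sum, map_smul, MvPolynomial.smul_eval, ← Finset.sum_sub_distrib, ← mul_sub]
    refine IsUltrametricDist.norm_sum_le_of_forall_le_of_nonneg hδ.le fun l _ => ?_
    rw [norm_mul]
    exact (mul_le_of_le_one_left (norm_nonneg _) (hvle l)).trans
      (norm_eval_partialDeriv_sub_le _ _ hδ α hx)
  have hPcoeff (m : Fin d →₀ ℕ) (hm : m ≠ 0) : ‖P.coeff m‖ ≤ max M 1 := by
    simp only [hP, MvPolynomial.coeff_sum, MvPolynomial.coeff_smul]
    refine IsUltrametricDist.norm_sum_le_of_forall_le_of_nonneg hM0.le fun l _ => ?_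
    rw [norm_smul, coeff_truncation]
    refine (mul_le_of_le_one_left (norm_nonneg _) (hvle l)).trans ?_
    split_ifs
    · exact ((IsConvergent.norm_coeff_le hf l hm).trans_eq hfM).trans (le_max_left _ _)
    · simp
  have hPder (x : Fin d → K) (hx : x ∈ polydisc K d) : ∃ α : Fin d → ℕ, 0 < ∑ j, α j ∧
      ∑ j, α j ≤ k ∧ 1 ≤ ‖MvPolynomial.eval x (polyPartialDeriv α P)‖ := by
    obtain ⟨α, h0, h1, h2⟩ := hder v hv1 x hx
    refine ⟨α, h0, h1, ?_⟩
    have h3 := hPapprox α x hx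
    rw [norm_sub_rev] at h3
    rw [norm_eq_of_norm_sub_lt
      ((h3.trans_lt (hδlt.trans_le (min_le_left _ _))).trans_le h2)]
    exact h2
  have key := norm_integral_polynomial_le hK hϖ hk hM1 hs hψ hψ1 P hPcoeff hPder hlam
  rw [hynorm]
  refine le_trans (le_of_eq ?_) key
  congr 1
  refine setIntegral_congr_fun (measurableSet_polydisc d) fun x hx => ?_
  have h1 := hPapprox 0 x hx
  simp only [partialDeriv_zero, polyPartialDeriv_zero] at h1
  have h2 : ‖y l₀ * (∑ l, v l * eval (f l) x - MvPolynomial.eval x P)‖ < 1 := by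
    rw [norm_mul]
    calc _ ≤ ‖y l₀‖ * δ := by gcongr
      _ < ‖y l₀‖ * ‖y l₀‖⁻¹ := by
          gcongr
          exact hδlt.trans_le (min_le_right _ _)
      _ = 1 := mul_inv_cancel₀ hlam0.ne'
  have h3 : ∑ l, y l * eval (f l) x =
      y l₀ * (∑ l, v l * eval (f l) x - MvPolynomial.eval x P) + y l₀ * MvPolynomial.eval x P := by
    rw [← mul_add, sub_add_cancel, Finset.mul_sum]
    exact Finset.sum_congr rfl fun l _ => by rw [hyv l, mul_assoc]
  have h4 : ψ (∑ l, y l * eval (f l) x) = ψ (y l₀ * MvPolynomial.eval x P) := by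
    rw [h3, AddChar.map_add_eq_mul, hψ _ h2, one_mul]
  exact congrArg (fun z : Circle => (z : ℂ)) h4
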